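/- Let $q\in(0,\infty)$ and let $m_q(dt)=t^{2q-1}e^{-t}\,dt$ on $(0,\infty)$. On the complex Hilbert space $L^2(m_q)$ let $P_q^{\pm}=M\pm N_q$, where $$(M\varphi)(t)=e^{-t}\varphi(t),\qquad (N_q\varphi)(t)=\int_0^\infty \frac{J_{2q-1}\left(2\sqrt{st}\right)}{(st)^{q-1/2}}\,\varphi(s)\,m_q(ds),$$ and $J_p$ is the Bessel function of the first kind of order $p$; these are bounded operators on $L^2(m_q)$. Put $\gamma=\frac{\sqrt5-1}{2}$. Then, for each choice of the sign: 1. $\lambda=0$ is an eigenvalue of $P_q^{\pm}$ of infinite multiplicity. 2. All eigenvalues of $P_q^{\pm}$ are real and lie in $[0,1+\gamma^{2q}]$. 3. Every eigenvalue of $P_q^{\pm}$ that does not lie in $[0,1]$ is an isolated point of the spectrum of $P_q^{\pm}$ and has finite multiplicity. 4. The essential spectrum of $P_q^{\pm}$, that is, the set of $z\in\mathbb C$ for which $z-P_q^{\pm}$ is not a Fredholm operator, is $[0,1]$. -/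

import Mathlib

open MeasureTheory Set

noncomputable section

namespace FareyTransfer

/-! ### The Bessel function of the first kind -/

/-- The Bessel function of the first kind `J_p(x)` of real order `p`, for `x > 0`, by its series
`∑ (-1)^n / (n! Γ(n+p+1)) (x/2)^(2n+p)`. -/
def besselJ (p x : ℝ) : ℝ :=
  ∑' n : ℕ, (-1) ^ n / (n.factorial * Real.Gamma (n + p + 1)) * (x / 2) ^ (2 * (n : ℝ) + p)

/-- Auxiliary entire function `∑ (-x)^n / (n! Γ(n+b))`; one has
`J_p(2√x) = x^(p/2) * clifford (p+1) x` for `x > 0`. -/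
def clifford (b x : ℝ) : ℝ :=
  ∑' n : ℕ, (-1) ^ n / (n.factorial * Real.Gamma (n + b)) * x ^ n

lemma exists_gamma_lower {b : ℝ} (hb : 0 < b) :
    ∃ c : ℝ, 0 < c ∧ ∀ n : ℕ, c ≤ Real.Gamma (n + b) := by
  have h0 := Real.Gamma_pos_of_pos hb
  have h1 : 0 < Real.Gamma (b + 1) := Real.Gamma_pos_of_pos (by linarith)
  refine ⟨min (Real.Gamma b) (Real.Gamma (b + 1)), lt_min h0 h1, fun n => ?_⟩
  rcases n with _ | n
  · simp
  · refine (min_le_right _ _).trans ?_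
    induction n with
    | zero => simp [add_comm]
    | succ k ih =>
      have hpos : (0 : ℝ) < ((k + 1 : ℕ) : ℝ) + b := by positivity
      have e : (((k + 1 + 1 : ℕ) : ℝ) + b) = (((k + 1 : ℕ) : ℝ) + b) + 1 := by push_cast; ring
      rw [e, Real.Gamma_add_one hpos.ne']
      have hg := Real.Gamma_pos_of_pos hpos
      have : (1 : ℝ) ≤ ((k + 1 : ℕ) : ℝ) + b := by
        push_cast
        have : (0 : ℝ) ≤ k := Nat.cast_nonneg k
        linarith
      nlinarith

lemma clifford_coeff_bound {b : ℝ} (hb : 0 < b) :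
    ∃ K : ℝ, 0 < K ∧ ∀ n : ℕ,
      |(-1) ^ n / (n.factorial * Real.Gamma (n + b))| ≤ K / n.factorial := by
  obtain ⟨c, hc, h⟩ := exists_gamma_lower hb
  refine ⟨1 / c, by positivity, fun n => ?_⟩
  have hf : (0 : ℝ) < n.factorial := by positivity
  have hg : 0 < Real.Gamma (n + b) := hc.trans_le (h n)
  rw [abs_div, abs_pow, abs_neg, abs_one, one_pow, abs_of_pos (by positivity), div_div]
  refine one_div_le_one_div_of_le (by positivity) ?_
  rw [mul_comm c]
  exact mul_le_mul_of_nonneg_left (h n) hf.le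

lemma summable_clifford {b : ℝ} (hb : 0 < b) (x : ℝ) :
    Summable fun n : ℕ => (-1) ^ n / (n.factorial * Real.Gamma (n + b)) * x ^ n := by
  obtain ⟨K, hK, h⟩ := clifford_coeff_bound hb
  refine Summable.of_norm_bounded ((Real.summable_pow_div_factorial |x|).mul_left K) fun n => ?_
  rw [Real.norm_eq_abs, abs_mul, abs_pow]
  calc _ ≤ K / n.factorial * |x| ^ n := by gcongr; exact h n
    _ = _ := by ring

lemma summable_deriv_bound (K R : ℝ) :
    Summable fun n : ℕ => K / n.factorial * (n * R ^ (n - 1)) := by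
  rw [← summable_nat_add_iff 1]
  refine ((Real.summable_pow_div_factorial R).mul_left K).congr fun n => ?_
  have : ((n : ℝ) + 1) ≠ 0 := by positivity
  simp only [Nat.factorial_succ, Nat.cast_mul, Nat.cast_add, Nat.cast_one, Nat.add_sub_cancel]
  field_simp

lemma hasDerivAt_clifford_aux {b : ℝ} (hb : 0 < b) (x : ℝ) :
    HasDerivAt (clifford b)
      (∑' n : ℕ, (-1) ^ n / (n.factorial * Real.Gamma (n + b)) * (n * x ^ (n - 1))) x := by
  obtain ⟨K, hK, h⟩ := clifford_coeff_bound hb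
  have hx : x ∈ Metric.ball (0 : ℝ) (|x| + 1) := by simp
  refine hasDerivAt_tsum_of_isPreconnected (summable_deriv_bound K (|x| + 1)) Metric.isOpen_ball
    (convex_ball (0 : ℝ) (|x| + 1)).isPreconnected
    (fun n y _ => (hasDerivAt_pow n y).const_mul _) (fun n y hy => ?_) hx
    (summable_clifford hb x) hx
  have hy' : |y| ≤ |x| + 1 := by simpa using (Metric.mem_ball.1 hy).le
  rw [Real.norm_eq_abs, abs_mul, abs_mul, abs_pow, Nat.abs_cast]
  gcongr
  exact h n

lemma summable_clifford_deriv {b : ℝ} (hb : 0 < b) (x : ℝ) :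
    Summable fun n : ℕ =>
      (-1) ^ n / (n.factorial * Real.Gamma (n + b)) * (n * x ^ (n - 1)) := by
  obtain ⟨K, hK, h⟩ := clifford_coeff_bound hb
  refine Summable.of_norm_bounded (summable_deriv_bound K |x|) fun n => ?_
  rw [Real.norm_eq_abs, abs_mul, abs_mul, abs_pow, Nat.abs_cast]
  gcongr
  exact h n

lemma hasDerivAt_clifford {b : ℝ} (hb : 0 < b) (x : ℝ) :
    HasDerivAt (clifford b) (-clifford (b + 1) x) x := by
  convert hasDerivAt_clifford_aux hb x using 1
  rw [(summable_clifford_deriv hb x).tsum_eq_zero_add, clifford, ← tsum_neg]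
  simp only [Nat.cast_zero, zero_mul, mul_zero, zero_add]
  refine tsum_congr fun n => ?_
  have h1 : ((n : ℝ) + 1) ≠ 0 := by positivity
  have e : ((n + 1 : ℕ) : ℝ) + b = n + (b + 1) := by push_cast; ring
  have hg : Real.Gamma (n + (b + 1)) ≠ 0 := (Real.Gamma_pos_of_pos (by positivity)).ne'
  have hf : (n.factorial : ℝ) ≠ 0 := by positivity
  rw [e]
  simp only [Nat.factorial_succ, Nat.cast_mul, Nat.cast_add, Nat.cast_one, Nat.add_sub_cancel]
  field_simp
  ring

lemma continuous_clifford {b : ℝ} (hb : 0 < b) : Continuous (clifford b) :=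
  continuous_iff_continuousAt.2 fun x => (hasDerivAt_clifford hb x).continuousAt

lemma clifford_recurrence {b : ℝ} (hb : 0 < b) (x : ℝ) :
    clifford b x = b * clifford (b + 1) x - x * clifford (b + 2) x := by
  have hb1 : 0 < b + 1 := by linarith
  have hd := (hasDerivAt_clifford hb1 x).unique (hasDerivAt_clifford_aux hb1 x)
  rw [show b + 1 + 1 = b + 2 by ring] at hd
  rw [sub_eq_add_neg, ← mul_neg, hd, clifford, clifford, ← tsum_mul_left, ← tsum_mul_left,
    ← ((summable_clifford hb1 x).mul_left b).tsum_add ((summable_clifford_deriv hb1 x).mul_left x)]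
  refine tsum_congr fun n => ?_
  have hpos : 0 < (n : ℝ) + b := by positivity
  have hg : Real.Gamma (n + b) ≠ 0 := (Real.Gamma_pos_of_pos hpos).ne'
  have hf : (n.factorial : ℝ) ≠ 0 := by positivity
  have hx : x * (n * x ^ (n - 1)) = n * x ^ n := by
    rcases n with _ | n
    · simp
    · rw [Nat.add_sub_cancel, pow_succ]; ring
  rw [show (n : ℝ) + (b + 1) = n + b + 1 by ring, Real.Gamma_add_one hpos.ne',
    mul_left_comm x, hx]
  have := hpos.ne'
  field_simp
  ring

lemma clifford_zero (b : ℝ) : clifford b 0 = 1 / Real.Gamma b := by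
  rw [clifford, tsum_eq_single 0 (fun n hn => by simp [hn])]
  simp

/-- Boundedness on the half line, by monotonicity of the energy `y² + x y'²`. -/
lemma abs_clifford_le {b : ℝ} (hb : 1 / 2 ≤ b) {x : ℝ} (hx : 0 ≤ x) :
    |clifford b x| ≤ 1 / Real.Gamma b := by
  have hb0 : 0 < b := by linarith
  have hb1 : 0 < b + 1 := by linarith
  have hE : ∀ y, HasDerivAt (fun y => clifford b y ^ 2 + y * clifford (b + 1) y ^ 2)
      ((1 - 2 * b) * clifford (b + 1) y ^ 2) y := by
    intro y
    have h1 := ((hasDerivAt_clifford hb0 y).fun_pow 2).fun_add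
      ((hasDerivAt_id' y).fun_mul ((hasDerivAt_clifford hb1 y).fun_pow 2))
    refine h1.congr_deriv ?_
    rw [show b + 1 + 1 = b + 2 by ring, clifford_recurrence hb0 y]
    push_cast
    ring
  have hanti : Antitone fun y => clifford b y ^ 2 + y * clifford (b + 1) y ^ 2 := by
    refine antitone_of_deriv_nonpos (fun y => (hE y).differentiableAt) fun y => ?_
    rw [(hE y).deriv]
    exact mul_nonpos_of_nonpos_of_nonneg (by linarith) (sq_nonneg _)
  have h := hanti hx
  simp only [zero_mul, add_zero, clifford_zero] at h
  have hg := Real.Gamma_pos_of_pos hb0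
  refine abs_le_of_sq_le_sq (le_trans ?_ h) (by positivity)
  have : 0 ≤ x * clifford (b + 1) x ^ 2 := by positivity
  linarith

lemma exists_clifford_bound {b : ℝ} (hb : 0 < b) :
    ∃ K : ℝ, 0 < K ∧ ∀ x, 0 ≤ x → |clifford b x| ≤ K * (1 + x) := by
  have g1 := Real.Gamma_pos_of_pos (show 0 < b + 1 by linarith)
  have g2 := Real.Gamma_pos_of_pos (show 0 < b + 2 by linarith)
  refine ⟨b * (1 / Real.Gamma (b + 1)) + 1 / Real.Gamma (b + 2), by positivity, fun x hx => ?_⟩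
  have h1 := abs_clifford_le (b := b + 1) (by linarith) hx
  have h2 := abs_clifford_le (b := b + 2) (by linarith) hx
  rw [clifford_recurrence hb]
  calc _ ≤ |b * clifford (b + 1) x| + |x * clifford (b + 2) x| := abs_sub _ _
    _ = b * |clifford (b + 1) x| + x * |clifford (b + 2) x| := by
      rw [abs_mul, abs_mul, abs_of_pos hb, abs_of_nonneg hx]
    _ ≤ b * (1 / Real.Gamma (b + 1)) + x * (1 / Real.Gamma (b + 2)) := by gcongr
    _ ≤ _ := by
      have p1 : 0 ≤ b * (1 / Real.Gamma (b + 1)) * x := by positivity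
      have p2 : 0 < 1 / Real.Gamma (b + 2) := by positivity
      nlinarith

/-! ### The measure and the kernel -/

/-- The measure `m_q(dt) = t^(2q-1) e^(-t) dt` on `(0, ∞)`. -/
def mq (q : ℝ) : Measure ℝ :=
  (volume.restrict (Ioi 0)).withDensity
    fun t => ENNReal.ofReal (t ^ (2 * q - 1) * Real.exp (-t))

/-- The complex Hilbert space `L²(m_q)`. -/
abbrev L2mq (q : ℝ) : Type := Lp ℂ 2 (mq q)

/-- The kernel `J_{2q-1}(2√(st)) / (st)^(q-1/2)`, for `s, t > 0`. -/
def kernel (q s t : ℝ) : ℝ :=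
  besselJ (2 * q - 1) (2 * √(s * t)) / (s * t) ^ (q - 1 / 2)

lemma kernel_eq (q : ℝ) {s t : ℝ} (hs : 0 < s) (ht : 0 < t) :
    kernel q s t = clifford (2 * q) (s * t) := by
  have hst : 0 < s * t := mul_pos hs ht
  have hp : (s * t) ^ (q - 1 / 2) ≠ 0 := (Real.rpow_pos_of_pos hst _).ne'
  rw [kernel, div_eq_iff hp, besselJ, clifford, ← tsum_mul_right]
  refine tsum_congr fun n => ?_
  rw [mul_div_cancel_left₀ _ (two_ne_zero' ℝ), Real.sqrt_eq_rpow, ← Real.rpow_mul hst.le,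
    mul_assoc _ ((s * t) ^ n), ← Real.rpow_natCast (s * t) n, ← Real.rpow_add hst]
  congr 3 <;> ring_nf

lemma ae_mq_pos (q : ℝ) : ∀ᵐ t ∂(mq q), 0 < t :=
  (withDensity_absolutelyContinuous _ _).ae_le (ae_restrict_mem measurableSet_Ioi)

lemma integrable_pow_mq {q : ℝ} (hq : 0 < q) (n : ℕ) :
    Integrable (fun t : ℝ => t ^ n) (mq q) := by
  have hm : Measurable fun t : ℝ => ENNReal.ofReal (t ^ (2 * q - 1) * Real.exp (-t)) := by
    fun_prop
  rw [mq, integrable_withDensity_iff hm (by simp)]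
  have h := Real.GammaIntegral_convergent (s := n + 2 * q) (by positivity)
  refine (integrableOn_congr_fun (fun t ht => ?_) measurableSet_Ioi).1 h
  have ht : 0 < t := ht
  have e : (n : ℝ) + 2 * q - 1 = n + (2 * q - 1) := by ring
  simp only [ENNReal.toReal_ofReal (show 0 ≤ t ^ (2 * q - 1) * Real.exp (-t) by positivity)]
  rw [e, Real.rpow_add ht, Real.rpow_natCast]
  ring

instance sFinite_mq (q : ℝ) : SFinite (mq q) := by unfold mq; infer_instance

lemma memLp_weight {q : ℝ} (hq : 0 < q) : MemLp (fun t : ℝ => ((1 + t : ℝ) : ℂ)) 2 (mq q) := by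
  have hc : Continuous fun t : ℝ => ((1 + t : ℝ) : ℂ) := by fun_prop
  rw [memLp_two_iff_integrable_sq_norm hc.aestronglyMeasurable]
  refine (((integrable_pow_mq hq 0).add ((integrable_pow_mq hq 1).const_mul 2)).add
    (integrable_pow_mq hq 2)).congr (Filter.Eventually.of_forall fun t => ?_)
  simp only [Pi.add_apply, Complex.norm_real, Real.norm_eq_abs, sq_abs]
  ring

/-- A bound `|kernel q s t| ≤ K (1+s) (1+t)` on the quadrant. -/
lemma exists_kernel_bound {q : ℝ} (hq : 0 < q) :
    ∃ K : ℝ, 0 < K ∧ ∀ s t, 0 < s → 0 < t → |kernel q s t| ≤ K * (1 + t) * (1 + s) := by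
  obtain ⟨K, hK, h⟩ := exists_clifford_bound (b := 2 * q) (by positivity)
  refine ⟨K, hK, fun s t hs ht => ?_⟩
  rw [kernel_eq q hs ht]
  have := h (s * t) (by positivity)
  have h2 : K * (1 + s * t) ≤ K * ((1 + t) * (1 + s)) := by
    gcongr
    nlinarith
  linarith

/-! ### The operators -/

lemma integrable_weight_mul {q : ℝ} (hq : 0 < q) (φ : L2mq q) :
    Integrable (fun s => ((1 + s : ℝ) : ℂ) * φ s) (mq q) :=
  (memLp_weight hq).integrable_mul (Lp.memLp φ)

/-- The integral defining `N_q φ (t)` converges absolutely for every `t > 0`. -/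
lemma integrable_kernel_mul {q : ℝ} (hq : 0 < q) (φ : L2mq q) {t : ℝ} (ht : 0 < t) :
    Integrable (fun s => (kernel q s t : ℂ) * φ s) (mq q) := by
  obtain ⟨K, hK, h⟩ := exists_kernel_bound hq
  have hcl := continuous_clifford (b := 2 * q) (by positivity)
  have hm : AEStronglyMeasurable (fun s => (kernel q s t : ℂ)) (mq q) := by
    have hc : Continuous fun s => ((clifford (2 * q) (s * t) : ℝ) : ℂ) := by fun_prop
    refine hc.aestronglyMeasurable.congr ?_
    filter_upwards [ae_mq_pos q] with s hs
    rw [kernel_eq q hs ht]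
  refine ((integrable_weight_mul hq φ).norm.const_mul (K * (1 + t))).mono'
    (hm.mul (Lp.aestronglyMeasurable φ)) ?_
  filter_upwards [ae_mq_pos q] with s hs
  have := h s t hs ht
  rw [norm_mul, norm_mul, Complex.norm_real, Complex.norm_real, Real.norm_eq_abs,
    Real.norm_eq_abs, abs_of_pos (show 0 < 1 + s by linarith), ← mul_assoc]
  gcongr

/-- `N_q φ (t) = ∫₀^∞ J_{2q-1}(2√(st)) / (st)^(q-1/2) φ(s) m_q(ds)`. -/
def kernelIntegral (q : ℝ) (φ : ℝ → ℂ) (t : ℝ) : ℂ :=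
  ∫ s, (kernel q s t : ℂ) * φ s ∂(mq q)

lemma norm_integral_weight_le {q : ℝ} (hq : 0 < q) (φ : L2mq q) :
    ∫ s, ‖((1 + s : ℝ) : ℂ) * φ s‖ ∂(mq q) ≤ ‖(memLp_weight hq).toLp‖ * ‖φ‖ := by
  have h := integral_mul_norm_le_Lp_mul_Lq (μ := mq q) (f := fun s : ℝ => ((1 + s : ℝ) : ℂ))
    (g := φ) (p := 2) (q := 2) (by constructor <;> norm_num)
    (by simpa using memLp_weight hq) (by simpa using Lp.memLp φ)
  have e1 : ‖(memLp_weight hq).toLp‖ =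
      (∫ s, ‖((1 + s : ℝ) : ℂ)‖ ^ (2 : ℝ) ∂(mq q)) ^ (1 / 2 : ℝ) := by
    rw [Lp.norm_toLp, (memLp_weight hq).eLpNorm_eq_integral_rpow_norm (by simp) (by simp),
      ENNReal.toReal_ofReal (by positivity)]
    simp
  have e2 : ‖φ‖ = (∫ s, ‖φ s‖ ^ (2 : ℝ) ∂(mq q)) ^ (1 / 2 : ℝ) := by
    rw [Lp.norm_def, (Lp.memLp φ).eLpNorm_eq_integral_rpow_norm (by simp) (by simp),
      ENNReal.toReal_ofReal (by positivity)]
    simp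
  rw [e1, e2]
  simpa only [norm_mul] using h

lemma exists_kernelIntegral_bound {q : ℝ} (hq : 0 < q) :
    ∃ C : ℝ, 0 ≤ C ∧ ∀ (φ : L2mq q) (t : ℝ), 0 < t →
      ‖kernelIntegral q φ t‖ ≤ C * ‖φ‖ * ‖((1 + t : ℝ) : ℂ)‖ := by
  obtain ⟨K, hK, h⟩ := exists_kernel_bound hq
  refine ⟨K * ‖(memLp_weight hq).toLp‖, by positivity, fun φ t ht => ?_⟩
  have hle : ‖kernelIntegral q φ t‖ ≤
      ∫ s, K * (1 + t) * ‖((1 + s : ℝ) : ℂ) * φ s‖ ∂(mq q) := by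
    refine norm_integral_le_of_norm_le ((integrable_weight_mul hq φ).norm.const_mul _) ?_
    filter_upwards [ae_mq_pos q] with s hs
    have := h s t hs ht
    rw [norm_mul, norm_mul, Complex.norm_real, Complex.norm_real, Real.norm_eq_abs,
      Real.norm_eq_abs, abs_of_pos (show 0 < 1 + s by linarith), ← mul_assoc]
    gcongr
  rw [integral_const_mul] at hle
  refine hle.trans ?_
  have h1 : 0 < 1 + t := by linarith
  have := mul_le_mul_of_nonneg_left (norm_integral_weight_le hq φ)
    (show 0 ≤ K * (1 + t) by positivity)
  rw [Complex.norm_real, Real.norm_eq_abs, abs_of_pos h1]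
  linarith

lemma aestronglyMeasurable_kernelIntegral {q : ℝ} (hq : 0 < q) (φ : L2mq q) :
    AEStronglyMeasurable (kernelIntegral q φ) (mq q) := by
  have hcl := continuous_clifford (b := 2 * q) (by positivity)
  have hc : Continuous fun z : ℝ × ℝ => ((clifford (2 * q) (z.2 * z.1) : ℝ) : ℂ) := by fun_prop
  have hm : StronglyMeasurable fun z : ℝ × ℝ =>
      ((clifford (2 * q) (z.2 * z.1) : ℝ) : ℂ) * φ z.2 :=
    hc.stronglyMeasurable.mul ((Lp.stronglyMeasurable φ).comp_measurable measurable_snd)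
  refine (hm.integral_prod_right' (ν := mq q)).aestronglyMeasurable.congr ?_
  filter_upwards [ae_mq_pos q] with t ht
  refine integral_congr_ae ?_
  filter_upwards [ae_mq_pos q] with s hs
  rw [kernel_eq q hs ht]

lemma memLp_kernelIntegral {q : ℝ} (hq : 0 < q) (φ : L2mq q) :
    MemLp (kernelIntegral q φ) 2 (mq q) := by
  obtain ⟨C, -, h⟩ := exists_kernelIntegral_bound hq
  refine (memLp_weight hq).of_le_mul (c := C * ‖φ‖)
    (aestronglyMeasurable_kernelIntegral hq φ) ?_
  filter_upwards [ae_mq_pos q] with t ht using h φ t ht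

/-- The integral operator `N_q` on `L²(m_q)`. -/
def opN {q : ℝ} (hq : 0 < q) : L2mq q →L[ℂ] L2mq q :=
  LinearMap.mkContinuousOfExistsBound
    { toFun := fun φ => (memLp_kernelIntegral hq φ).toLp
      map_add' := fun φ ψ => by
        rw [← MemLp.toLp_add, MemLp.toLp_eq_toLp_iff]
        filter_upwards [ae_mq_pos q] with t ht
        rw [Pi.add_apply, kernelIntegral, kernelIntegral, kernelIntegral,
          ← integral_add (integrable_kernel_mul hq φ ht) (integrable_kernel_mul hq ψ ht)]
        refine integral_congr_ae ?_
        filter_upwards [Lp.coeFn_add φ ψ] with s hs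
        rw [hs, Pi.add_apply, mul_add]
      map_smul' := fun c φ => by
        rw [RingHom.id_apply, ← MemLp.toLp_const_smul, MemLp.toLp_eq_toLp_iff]
        filter_upwards [ae_mq_pos q] with t ht
        rw [Pi.smul_apply, kernelIntegral, kernelIntegral, ← integral_smul]
        refine integral_congr_ae ?_
        filter_upwards [Lp.coeFn_smul c φ] with s hs
        rw [hs, Pi.smul_apply, smul_eq_mul, smul_eq_mul, mul_left_comm] }
    (by
      obtain ⟨C, hC, h⟩ := exists_kernelIntegral_bound hq
      refine ⟨C * ‖(memLp_weight hq).toLp‖, fun φ => ?_⟩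
      have := Lp.norm_le_mul_norm_of_ae_le_mul (c := C * ‖φ‖)
        (f := (memLp_kernelIntegral hq φ).toLp) (g := (memLp_weight hq).toLp) (by
          filter_upwards [ae_mq_pos q, (memLp_kernelIntegral hq φ).coeFn_toLp,
            (memLp_weight hq).coeFn_toLp] with t ht h1 h2
          rw [h1, h2]
          exact h φ t ht)
      calc _ ≤ _ := this
        _ = _ := by ring)

lemma opN_apply {q : ℝ} (hq : 0 < q) (φ : L2mq q) :
    opN hq φ =ᵐ[mq q] fun t => ∫ s, (kernel q s t : ℂ) * φ s ∂(mq q) :=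
  (memLp_kernelIntegral hq φ).coeFn_toLp

lemma ae_norm_exp_mul_le {q : ℝ} (φ : L2mq q) :
    ∀ᵐ t ∂(mq q), ‖(Real.exp (-t) : ℂ) * φ t‖ ≤ 1 * ‖φ t‖ := by
  filter_upwards [ae_mq_pos q] with t ht
  rw [norm_mul, Complex.norm_real, Real.norm_eq_abs, Real.abs_exp]
  gcongr
  exact Real.exp_le_one_iff.2 (by linarith)

lemma memLp_exp_mul {q : ℝ} (φ : L2mq q) :
    MemLp (fun t => (Real.exp (-t) : ℂ) * φ t) 2 (mq q) := by
  have hc : Continuous fun t : ℝ => (Real.exp (-t) : ℂ) := by fun_prop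
  exact (Lp.memLp φ).of_le_mul (hc.aestronglyMeasurable.mul (Lp.aestronglyMeasurable φ))
    (ae_norm_exp_mul_le φ)

/-- The multiplication operator `(M φ)(t) = e^(-t) φ(t)` on `L²(m_q)`. -/
def opM (q : ℝ) : L2mq q →L[ℂ] L2mq q :=
  LinearMap.mkContinuous
    { toFun := fun φ => (memLp_exp_mul φ).toLp
      map_add' := fun φ ψ => by
        rw [← MemLp.toLp_add, MemLp.toLp_eq_toLp_iff]
        filter_upwards [Lp.coeFn_add φ ψ] with s hs
        rw [hs, Pi.add_apply, Pi.add_apply, mul_add]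
      map_smul' := fun c φ => by
        rw [RingHom.id_apply, ← MemLp.toLp_const_smul, MemLp.toLp_eq_toLp_iff]
        filter_upwards [Lp.coeFn_smul c φ] with s hs
        rw [hs, Pi.smul_apply, Pi.smul_apply, smul_eq_mul, smul_eq_mul, mul_left_comm] }
    1
    (fun φ => Lp.norm_le_mul_norm_of_ae_le_mul (by
      filter_upwards [(memLp_exp_mul φ).coeFn_toLp, ae_norm_exp_mul_le φ] with t h1 h2
      exact h1 ▸ h2))

lemma opM_apply (q : ℝ) (φ : L2mq q) :
    opM q φ =ᵐ[mq q] fun t => (Real.exp (-t) : ℂ) * φ t :=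
  (memLp_exp_mul φ).coeFn_toLp

/-- The operators `P_q^± = M ± N_q` on `L²(m_q)`; the sign is `ε = ±1`. -/
def opP {q : ℝ} (hq : 0 < q) (ε : ℤˣ) : L2mq q →L[ℂ] L2mq q :=
  opM q + ((ε : ℤ) : ℂ) • opN hq

/-- The essential spectrum of a bounded operator `T`: the set of all `z` for which `z - T` is not a
Fredholm operator. -/
def essentialSpectrum {E : Type*} [NormedAddCommGroup E] [NormedSpace ℂ E] (T : E →L[ℂ] E) :
    Set ℂ :=
  {z | ¬ (algebraMap ℂ (E →L[ℂ] E) z - T).IsFredholm}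

end FareyTransfer

end

/-!
Everything is computed on the exponentials `e_b(t) = e^(-bt)`, `b > -1/2`. They satisfy
`⟨e_b, e_c⟩ = Γ(2q) (1 + b + c)^(-2q)`, `M e_b = e_(1+b)` and, integrating the Bessel series term by
term, `N_q e_b = (1 + b)^(-2q) e_(1/(1+b))` (`opN_expVec`). By Weierstrass approximation in the
variable `e^(-t)`, the `e_n` with `n ∈ ℕ` span a dense subspace (`dense_span_expVec`), so symmetry
of `N_q` and bounds on quadratic forms can be checked on them.

*The kernel.* Multiplication by `e^(-t)` turns `P_q^± φ = 0` into the equation `h ψ = ∓ψ` for the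
Hankel transform `h` and `ψ = e^(-t) φ`. As `h` exchanges `e_a` and `e_(1/a)` up to factors, each
`a ∈ (1, 2)` gives a solution, and these are linearly independent (`opP_apply_sub_eq_zero`,
`linearIndependent_expVec`).

*The eigenvalues.* They are real since `P_q^±` is symmetric. They are nonnegative since
`⟨P_q^± φ, φ⟩ = ‖ψ ± h ψ‖² / 2`, where `h` is a symmetric isometry of `L²(t^(2q-1) dt)`
(`re_inner_opP_nonneg`). The upper bound is `‖M‖ + ‖N_q‖` with `‖N_q‖ ≤ γ^(2q)`
(`norm_opN_le`): with `g_b = (1 + γb)^(2q) e_b` one has `N_q g_b = γ^(2q) g_(1/(1+b))`, so the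
powers of `N_q` grow at most like `γ^(2qn)` on a total set, and for a symmetric operator this bounds
the norm (`norm_le_of_norm_pow_le_of_dense`).

*The essential spectrum.* By dominated convergence `N_q` maps bounded weakly null sequences to null
sequences (`tendsto_opN_of_weaklyNull`); hence it is a norm limit of operators of finite rank
(`exists_finiteRank_norm_sub_le`). For `z ∉ [0, 1]` the operator `z - M` is invertible, so
`z - P_q^±` is a finite rank perturbation of an invertible operator. For `z ∈ [0, 1]`, normalized
indicators of disjoint intervals where `e^(-t)` is close to `z` form a singular sequence for `M`,
hence for `P_q^±`, which excludes the Fredholm property (`not_isFredholm_of_weaklyNull`).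

*Isolated eigenvalues.* If `T` is self-adjoint and `z - T` is Fredholm, then `z - T` is bounded
below on the orthogonal complement of its kernel, so that `w - T` is invertible for all `w ≠ z`
near `z` (`exists_ball_inter_spectrum_subset`).
-/

noncomputable section

namespace FareyTransfer

open Filter Topology

/-! ### Bounded operators on a Hilbert space -/

section Hilbert

variable {H : Type*} [NormedAddCommGroup H] [InnerProductSpace ℂ H]

/-- Iterating `‖S x‖² ≤ ‖S² x‖ ‖x‖` over `S = T, T², T⁴, …`. The factor `‖x‖` on the left avoids
the exponent `2 ^ k - 1` on the right. -/
lemma norm_pow_two_pow_le {T : H →L[ℂ] H} (hT : T.IsSymmetric) (x : H) (k : ℕ) :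
    ‖T x‖ ^ 2 ^ k * ‖x‖ ≤ ‖(T ^ 2 ^ k) x‖ * ‖x‖ ^ 2 ^ k := by
  have key : ∀ m : ℕ, ‖(T ^ m) x‖ ^ 2 ≤ ‖(T ^ (2 * m)) x‖ * ‖x‖ := by
    intro m
    have hs : (T ^ m : H →L[ℂ] H).IsSymmetric := by
      have := LinearMap.IsSymmetric.pow (T := T.toLinearMap) hT m
      simpa using this
    have h1 : inner ℂ ((T ^ m) x) ((T ^ m) x) = inner ℂ ((T ^ (2 * m)) x) x := by
      have := hs ((T ^ m) x) x
      simp only [ContinuousLinearMap.coe_coe] at this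
      rw [← this, two_mul, pow_add]
      rfl
    rw [← inner_self_eq_norm_sq (𝕜 := ℂ), h1]
    exact re_inner_le_norm _ _
  induction k with
  | zero => simp
  | succ k ih =>
    rcases eq_or_ne x 0 with rfl | hx
    · simp
    have hx : 0 < ‖x‖ := norm_pos_iff.2 hx
    have h2 := key (2 ^ k)
    have h3 : (‖T x‖ ^ 2 ^ k * ‖x‖) ^ 2 ≤ (‖(T ^ 2 ^ k) x‖ * ‖x‖ ^ 2 ^ k) ^ 2 := by gcongr
    have h4 : (‖(T ^ 2 ^ k) x‖ * ‖x‖ ^ 2 ^ k) ^ 2 ≤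
        ‖(T ^ (2 * 2 ^ k)) x‖ * ‖x‖ * (‖x‖ ^ 2 ^ k) ^ 2 := by
      rw [mul_pow]; gcongr
    have h5 := h3.trans h4
    rw [pow_succ' 2 k]
    refine le_of_mul_le_mul_right ?_ hx
    calc _ = (‖T x‖ ^ 2 ^ k * ‖x‖) ^ 2 := by ring
      _ ≤ _ := h5
      _ = _ := by ring

/-- For a symmetric operator `T`, the growth rate of the orbit of `x` bounds the ratio
`‖T x‖ / ‖x‖`. -/
lemma norm_apply_le_of_norm_pow_le {T : H →L[ℂ] H} (hT : T.IsSymmetric) {r C : ℝ} (hr : 0 < r)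
    {x : H} (h : ∀ n : ℕ, ‖(T ^ n) x‖ ≤ C * r ^ n) : ‖T x‖ ≤ r * ‖x‖ := by
  rcases eq_or_ne x 0 with rfl | hx
  · simp
  have hx : 0 < ‖x‖ := norm_pos_iff.2 hx
  by_contra! hlt
  have hρ : 1 < ‖T x‖ / (r * ‖x‖) := by rwa [one_lt_div (by positivity)]
  have hb : ∀ k : ℕ, (‖T x‖ / (r * ‖x‖)) ^ 2 ^ k ≤ C / ‖x‖ := by
    intro k
    rw [div_pow, div_le_div_iff₀ (by positivity) hx]
    calc _ ≤ _ := norm_pow_two_pow_le hT x k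
      _ ≤ C * r ^ 2 ^ k * ‖x‖ ^ 2 ^ k := by gcongr; exact h _
      _ = _ := by ring
  obtain ⟨k, hk⟩ := ((tendsto_pow_atTop_atTop_of_one_lt hρ).comp
    (tendsto_pow_atTop_atTop_of_one_lt (one_lt_two (α := ℕ)))).eventually_gt_atTop
    (C / ‖x‖) |>.exists
  exact absurd (hb k) (not_le.2 hk)

/-- A symmetric operator has norm at most `r` as soon as its powers grow at most like `r ^ n` on
a set of vectors with dense span. -/
lemma norm_le_of_norm_pow_le_of_dense {T : H →L[ℂ] H} (hT : T.IsSymmetric) {r : ℝ} (hr : 0 < r)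
    {s : Set H} (hs : Dense (Submodule.span ℂ s : Set H))
    (h : ∀ x ∈ s, ∃ C, ∀ n : ℕ, ‖(T ^ n) x‖ ≤ C * r ^ n) : ‖T‖ ≤ r := by
  refine T.opNorm_le_bound hr.le fun x => ?_
  refine hs.induction (P := fun x => ‖T x‖ ≤ r * ‖x‖) (fun x hx => ?_)
    (isClosed_le (by fun_prop) (by fun_prop)) x
  suffices ∃ C, ∀ n : ℕ, ‖(T ^ n) x‖ ≤ C * r ^ n from
    norm_apply_le_of_norm_pow_le hT hr this.choose_spec
  induction hx using Submodule.span_induction with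
  | mem x hx => exact h x hx
  | zero => exact ⟨0, by simp⟩
  | add x y _ _ hx hy =>
    obtain ⟨C, hC⟩ := hx
    obtain ⟨D, hD⟩ := hy
    refine ⟨C + D, fun n => ?_⟩
    rw [map_add, add_mul]
    exact (norm_add_le _ _).trans (add_le_add (hC n) (hD n))
  | smul a x _ hx =>
    obtain ⟨C, hC⟩ := hx
    refine ⟨‖a‖ * C, fun n => ?_⟩
    rw [map_smul, norm_smul, mul_assoc]
    exact mul_le_mul_of_nonneg_left (hC n) (norm_nonneg _)

lemma isSymmetric_of_dense {T : H →L[ℂ] H} {s : Set H}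
    (hs : Dense (Submodule.span ℂ s : Set H))
    (h : ∀ x ∈ s, ∀ y ∈ s, inner ℂ (T x) y = inner ℂ x (T y)) : T.IsSymmetric := by
  intro x y
  simp only [ContinuousLinearMap.coe_coe]
  refine hs.induction (P := fun x => inner ℂ (T x) y = inner ℂ x (T y)) (fun x hx => ?_)
    (isClosed_eq (by fun_prop) (by fun_prop)) x
  refine hs.induction (P := fun y => inner ℂ (T x) y = inner ℂ x (T y)) (fun y hy => ?_)
    (isClosed_eq (by fun_prop) (by fun_prop)) y
  induction hx using Submodule.span_induction with
  | zero => simp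
  | add x₁ x₂ _ _ h₁ h₂ => simp only [map_add, inner_add_left, h₁, h₂]
  | smul a x _ hx => simp only [map_smul, inner_smul_left, hx]
  | mem x hx =>
    induction hy using Submodule.span_induction with
    | zero => simp
    | add y₁ y₂ _ _ h₁ h₂ => simp only [map_add, inner_add_right, h₁, h₂]
    | smul a y _ hy => simp only [map_smul, inner_smul_right, hy]
    | mem y hy => exact h x hx y hy

/-- Weak convergence to zero of a sequence in a Hilbert space. -/
def WeaklyNull (x : ℕ → H) : Prop :=
  ∀ y, Tendsto (fun n => inner ℂ y (x n)) atTop (𝓝 0)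

lemma weaklyNull_of_orthonormal {x : ℕ → H} (hx : Orthonormal ℂ x) : WeaklyNull x := by
  intro y
  have h := (hx.inner_products_summable (x := y)).tendsto_atTop_zero
  rw [tendsto_zero_iff_norm_tendsto_zero]
  have h2 := h.sqrt
  simpa [Real.sqrt_sq, norm_inner_symm] using h2

lemma WeaklyNull.tendsto_starProjection {x : ℕ → H} (hx : WeaklyNull x) (K : Submodule ℂ H)
    [FiniteDimensional ℂ K] : Tendsto (fun n => K.starProjection (x n)) atTop (𝓝 0) := by
  have e : ∀ n, K.starProjection (x n) =
      ∑ i, inner ℂ (stdOrthonormalBasis ℂ K i : H) (x n) • (stdOrthonormalBasis ℂ K i : H) := by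
    intro n
    rw [Submodule.starProjection_apply,
      (stdOrthonormalBasis ℂ K).orthogonalProjectionOnto_apply_eq_sum]
    simp
  simp_rw [e]
  have h := tendsto_finsetSum Finset.univ fun i _ =>
    (hx (stdOrthonormalBasis ℂ K i)).smul_const (stdOrthonormalBasis ℂ K i : H)
  simpa using h

/-- An operator on a separable Hilbert space that maps bounded weakly null sequences to null
sequences is a norm limit of operators of finite rank. -/
lemma exists_finiteRank_norm_sub_le {T : H →L[ℂ] H} {e : ℕ → H}
    (he : Dense (Submodule.span ℂ (range e) : Set H))
    (hT : ∀ x : ℕ → H, (∀ n, ‖x n‖ ≤ 1) → WeaklyNull x → Tendsto (fun n => T (x n)) atTop (𝓝 0))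
    {δ : ℝ} (hδ : 0 < δ) :
    ∃ F : H →L[ℂ] H, F.toLinearMap.HasFiniteRange ∧ ‖T - F‖ ≤ δ := by
  set V : ℕ → Submodule ℂ H := fun n => Submodule.span ℂ (e '' Iio n) with hV
  have hfin : ∀ n, FiniteDimensional ℂ (V n) := fun n =>
    FiniteDimensional.span_of_finite ℂ ((finite_Iio n).image e)
  have hmono : Monotone V := fun m n hmn => Submodule.span_mono (by gcongr)
  by_contra! hcon
  have hex : ∀ n, ∃ x ∈ (V n)ᗮ, ‖x‖ ≤ 1 ∧ δ ≤ ‖T x‖ := by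
    intro n
    have h1 := hcon (T ∘L (V n).starProjection) (by
      refine LinearMap.HasFiniteRange.comp_left ?_ T.toLinearMap
      have : FiniteDimensional ℂ (V n).starProjection.range := by
        rw [Submodule.range_starProjection]; infer_instance
      exact Submodule.FG.of_finite)
    by_contra! hc
    -- On a unit vector, `T - T P_n` is `T` applied to a vector of the orthogonal complement.
    refine absurd h1 (not_lt.2 (ContinuousLinearMap.opNorm_le_of_unit_norm hδ.le fun x hx => ?_))
    have h2 := hc (x - (V n).starProjection x) (Submodule.sub_starProjection_mem_orthogonal x) (by
      rw [← Submodule.starProjection_orthogonal_val, ← hx]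
      exact Submodule.norm_starProjection_apply_le _ _)
    simpa using h2.le
  choose x hxV hx1 hxT using hex
  have hw : WeaklyNull x := by
    intro y
    have hspan : ∀ y ∈ Submodule.span ℂ (range e), ∃ m, y ∈ V m := by
      intro y hy
      induction hy using Submodule.span_induction with
      | zero => exact ⟨0, zero_mem _⟩
      | mem y hy =>
        obtain ⟨k, rfl⟩ := hy
        exact ⟨k + 1, Submodule.subset_span ⟨k, by simp, rfl⟩⟩
      | add y₁ y₂ _ _ h₁ h₂ =>
        obtain ⟨m₁, h₁⟩ := h₁
        obtain ⟨m₂, h₂⟩ := h₂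
        exact ⟨max m₁ m₂, add_mem (hmono (le_max_left _ _) h₁) (hmono (le_max_right _ _) h₂)⟩
      | smul a y _ h =>
        obtain ⟨m, h⟩ := h
        exact ⟨m, Submodule.smul_mem _ a h⟩
    rw [Metric.tendsto_atTop]
    intro ε hε
    obtain ⟨y', hy', hyy⟩ := he.exists_dist_lt y hε
    obtain ⟨m, hm⟩ := hspan y' hy'
    refine ⟨m, fun n hn => ?_⟩
    -- `y'` lies in the `m`-th subspace, hence is orthogonal to `x n` for all `n ≥ m`.
    have h0 : inner ℂ y' (x n) = 0 := hxV n _ (hmono hn hm)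
    rw [dist_zero_right, ← sub_add_cancel y y', inner_add_left, h0, add_zero]
    refine (norm_inner_le_norm _ _).trans_lt ?_
    rw [← dist_eq_norm]
    nlinarith [hx1 n, dist_nonneg (x := y) (y := y')]
  have h0 := (hT x hx1 hw).norm
  rw [norm_zero] at h0
  exact absurd (ge_of_tendsto' h0 hxT) (not_le.2 hδ)

section Fredholm

variable [CompleteSpace H]

/-- On a Hilbert space, an operator that is bounded below together with its adjoint is
invertible. -/
lemma isUnit_of_le_norm_apply {T : H →L[ℂ] H} {c : ℝ} (hc : 0 < c)
    (h : ∀ x, c * ‖x‖ ≤ ‖T x‖) (h' : ∀ x, c * ‖x‖ ≤ ‖T.adjoint x‖) : IsUnit T := by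
  rw [ContinuousLinearMap.isUnit_iff_bijective,
    ContinuousLinearMap.bijective_iff_dense_range_and_antilipschitz]
  refine ⟨?_, ⟨⟨c⁻¹, by positivity⟩, T.antilipschitz_of_bound fun x => ?_⟩⟩
  · rw [Submodule.topologicalClosure_eq_top_iff, ContinuousLinearMap.orthogonal_range,
      Submodule.eq_bot_iff]
    intro x hx
    have h1 := h' x
    have h2 : T.adjoint x = 0 := hx
    rw [h2, norm_zero] at h1
    exact norm_le_zero_iff.1 (nonpos_of_mul_nonpos_right h1 hc)
  · change ‖x‖ ≤ c⁻¹ * ‖T x‖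
    rw [inv_mul_eq_div, le_div_iff₀ hc, mul_comm]
    exact h x

omit [CompleteSpace H] in
open LinearMap.FiniteRangeSetoid in
/-- The inverse of an invertible operator is a quasi-inverse of its finite rank perturbations. -/
lemma isFredholm_sub_of_isUnit {A F : H →L[ℂ] H} (hA : IsUnit A)
    (hF : F.toLinearMap.HasFiniteRange) : (A - F).IsFredholm := by
  obtain ⟨u, rfl⟩ := hA
  have h : ((↑u⁻¹ : H →L[ℂ] H).toLinearMap).IsQuasiInverse (u : H →L[ℂ] H).toLinearMap := by
    have h1 : (↑u⁻¹ : H →L[ℂ] H) * u = 1 := u.inv_mul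
    have h2 : (u : H →L[ℂ] H) * ↑u⁻¹ = 1 := u.mul_inv
    constructor
    · have : (↑u⁻¹ : H →L[ℂ] H).toLinearMap ∘ₗ (u : H →L[ℂ] H).toLinearMap = .id := by
        ext x; exact congrArg (fun S : H →L[ℂ] H => S x) h1
      rw [LinearMap.IsLeftQuasiInverse, this]
    · have : (u : H →L[ℂ] H).toLinearMap ∘ₗ (↑u⁻¹ : H →L[ℂ] H).toLinearMap = .id := by
        ext x; exact congrArg (fun S : H →L[ℂ] H => S x) h2
      rw [LinearMap.IsRightQuasiInverse, this]
  refine ContinuousLinearMap.IsFredholm.of_isQuasiInverse (v := (↑u⁻¹ : H →L[ℂ] H))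
    (h.congr (Setoid.refl _) ?_)
  rw [equiv_iff_hasFiniteRange]
  simpa using hF.neg

omit [CompleteSpace H] in
/-- A Fredholm operator is bounded below on the orthogonal complement of its kernel. -/
lemma exists_le_norm_apply_of_isFredholm {T : H →L[ℂ] H} (hT : T.IsFredholm) :
    ∃ c > 0, ∀ x ∈ (T.ker)ᗮ, c * ‖x‖ ≤ ‖T x‖ := by
  obtain ⟨pkg⟩ := hT.nonempty_fredholmPackage
  set v := pkg.quasiInverse
  refine ⟨(‖v‖ + 1)⁻¹, by positivity, fun x hx => ?_⟩
  have hk : T (x - v (T x)) = 0 := by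
    rw [map_sub, sub_eq_zero]
    have e : ∀ y, T y = pkg.equiv (pkg.decDom.proj y) := fun y =>
      congrArg (fun S : H →L[ℂ] H => S y) pkg.eq_equiv
    have hv : v (T x) = pkg.decDom.proj x := by
      rw [e]
      simp [v, ContinuousLinearMap.FredholmPackage.quasiInverse]
    rw [hv, e, e]
    simp [Submodule.projectionOnto_projection]
  -- `v T` is a projection along the kernel, so `v T x` differs from `x` by a vector orthogonal
  -- to `x`.
  have h1 : inner ℂ (x - v (T x)) x = 0 := hx _ hk
  have h2 : ‖x‖ ≤ ‖v (T x)‖ := by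
    have e : inner ℂ x x = inner ℂ (v (T x)) x := by
      rw [inner_sub_left, sub_eq_zero] at h1; exact h1
    have h3 : ‖x‖ * ‖x‖ ≤ ‖v (T x)‖ * ‖x‖ := by
      rw [← inner_self_eq_norm_mul_norm (𝕜 := ℂ), e]
      exact re_inner_le_norm _ _
    rcases (norm_nonneg x).eq_or_lt with h0 | h0
    · rw [← h0]; positivity
    · exact le_of_mul_le_mul_right h3 h0
  rw [inv_mul_le_iff₀ (by positivity)]
  refine (h2.trans (v.le_opNorm _)).trans ?_
  gcongr
  linarith

/-- Weyl's criterion: a Fredholm operator admits no singular sequence. -/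
lemma not_isFredholm_of_weaklyNull {T : H →L[ℂ] H} {x : ℕ → H} (hx1 : ∀ n, ‖x n‖ = 1)
    (hx : WeaklyNull x) (h : Tendsto (fun n => T (x n)) atTop (𝓝 0)) : ¬ T.IsFredholm := by
  intro hT
  obtain ⟨c, hc, hcT⟩ := exists_le_norm_apply_of_isFredholm hT
  have := hT.finite_ker
  have hp := hx.tendsto_starProjection T.ker
  have hlow : ∀ n, c * ‖x n - T.ker.starProjection (x n)‖ ≤ ‖T (x n)‖ := by
    intro n
    have hk : T (T.ker.starProjection (x n)) = 0 :=
      T.ker.starProjection_apply_mem (x n)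
    simpa [hk] using hcT _ (Submodule.sub_starProjection_mem_orthogonal (K := T.ker) (x n))
  have h1 : Tendsto (fun n => c * ‖x n - T.ker.starProjection (x n)‖) atTop (𝓝 0) :=
    squeeze_zero (fun n => by positivity) hlow (by simpa using h.norm)
  have h2 : Tendsto (fun n => x n - T.ker.starProjection (x n)) atTop (𝓝 0) := by
    rw [tendsto_zero_iff_norm_tendsto_zero]
    simpa [hc.ne'] using h1.const_mul c⁻¹
  have h3 := (h2.add hp).norm
  simp [hx1] at h3

/-- If `z - T` is Fredholm and `T` is self-adjoint, then `z` is an isolated point of the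
spectrum or lies in the resolvent set. -/
lemma exists_ball_inter_spectrum_subset {T : H →L[ℂ] H} (hT : T.IsSymmetric) {z : ℝ}
    (hz : (algebraMap ℂ (H →L[ℂ] H) z - T).IsFredholm) :
    ∃ r > 0, Metric.ball (z : ℂ) r ∩ spectrum ℂ T ⊆ {(z : ℂ)} := by
  obtain ⟨c, hc, hcT⟩ := exists_le_norm_apply_of_isFredholm hz
  set S := algebraMap ℂ (H →L[ℂ] H) z - T with hS
  refine ⟨c, hc, ?_⟩
  rintro w ⟨hw, hwT⟩
  rw [mem_singleton_iff]
  by_contra hne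
  have hd : 0 < ‖w - z‖ := norm_pos_iff.2 (sub_ne_zero.2 hne)
  have := hz.finite_ker
  -- The kernel of `S` and its orthogonal complement are invariant under `w - T = (w - z) + S`,
  -- which is bounded below by `‖w - z‖` on the former and by `c - ‖w - z‖` on the latter.
  have key : ∀ w : ℂ, w ≠ z → ‖w - z‖ < c → ∀ x,
      min ‖w - z‖ (c - ‖w - z‖) * ‖x‖ ≤ ‖w • x - T x‖ := by
    intro w hw hwc x
    have hS0 : ∀ y, S y = (z : ℂ) • y - T y := fun y => by simp [hS, Algebra.algebraMap_eq_smul_one]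
    have hSsym : ∀ a b, inner ℂ (S a) b = inner ℂ a (S b) := fun a b => by
      rw [hS0, hS0, inner_sub_left, inner_sub_right, inner_smul_left, inner_smul_right,
        Complex.conj_ofReal]
      exact congrArg _ (hT a b)
    set p := S.ker.starProjection x
    set y := x - p
    have hp : S p = 0 := S.ker.starProjection_apply_mem x
    have hy : y ∈ S.kerᗮ := Submodule.sub_starProjection_mem_orthogonal x
    have hx : x = p + y := by simp [y]
    have e : w • x - T x = (w - z) • p + ((w - z) • y + S y) := by
      have e1 : w • x - T x = (w - z) • x + S x := by rw [hS0, sub_smul]; abel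
      rw [e1, hx, map_add, hp, smul_add]; abel
    have o1 : inner ℂ p y = 0 := hy p hp
    have o2 : inner ℂ ((w - z) • p) ((w - z) • y + S y) = 0 := by
      rw [inner_smul_left, inner_add_right, inner_smul_right, o1, ← hSsym, hp]
      simp
    have n1 := norm_add_sq_eq_norm_sq_add_norm_sq_of_inner_eq_zero _ _ o1
    have n2 := norm_add_sq_eq_norm_sq_add_norm_sq_of_inner_eq_zero _ _ o2
    rw [← hx] at n1
    rw [← e, norm_smul] at n2
    set m := min ‖w - z‖ (c - ‖w - z‖)
    have hm0 : 0 ≤ m := le_min (norm_nonneg _) (by linarith)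
    have l1 : m * ‖p‖ ≤ ‖w - z‖ * ‖p‖ := by gcongr; exact min_le_left _ _
    have l2 : m * ‖y‖ ≤ ‖(w - z) • y + S y‖ := by
      have h1 := norm_sub_le ((w - z) • y + S y) ((w - z) • y)
      rw [add_sub_cancel_left, norm_smul] at h1
      have h2 := hcT y hy
      have h3 : m * ‖y‖ ≤ (c - ‖w - z‖) * ‖y‖ := by gcongr; exact min_le_right _ _
      linarith
    refine abs_le_of_sq_le_sq' ?_ (norm_nonneg _) |>.2
    have q1 := mul_self_le_mul_self (by positivity) l1
    have q2 := mul_self_le_mul_self (by positivity) l2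
    have q3 : (m * ‖x‖) ^ 2 = m * ‖p‖ * (m * ‖p‖) + m * ‖y‖ * (m * ‖y‖) := by
      linear_combination m ^ 2 * n1
    rw [q3, sq, n2]
    exact add_le_add q1 q2
  -- The adjoint of `w - T` is `conj w - T`, and `conj w` is as far from the real `z` as `w`.
  have hconj : ‖(starRingEnd ℂ) w - z‖ = ‖w - z‖ := by
    rw [← Complex.conj_ofReal z, ← map_sub, RCLike.norm_conj, Complex.conj_ofReal]
  have hwc : ‖w - z‖ < c := by rwa [Metric.mem_ball, dist_eq_norm] at hw
  have hne' : (starRingEnd ℂ) w ≠ z := by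
    rw [← sub_ne_zero, ← norm_pos_iff, hconj]; exact hd
  refine hwT (isUnit_of_le_norm_apply (lt_min hd (sub_pos.2 hwc)) (fun x => ?_) fun x => ?_)
  · simpa [Algebra.algebraMap_eq_smul_one] using key w hne hwc x
  · have hTa : T.adjoint = T := (ContinuousLinearMap.isSelfAdjoint_iff_isSymmetric.2 hT)
    have h := key _ hne' (by rwa [hconj]) x
    rw [hconj] at h
    rw [Algebra.algebraMap_eq_smul_one, map_sub, hTa, map_smulₛₗ,
      ContinuousLinearMap.adjoint_one]
    simpa using h

end Fredholm

end Hilbert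

/-! ### Exponential functions in `L²(m_q)` -/

lemma integrable_pow_mul_exp {q : ℝ} (hq : 0 < q) {c : ℝ} (hc : -1 < c) (n : ℕ) :
    Integrable (fun t : ℝ => t ^ n * Real.exp (-(c * t))) (mq q) := by
  have hm : Measurable fun t : ℝ => ENNReal.ofReal (t ^ (2 * q - 1) * Real.exp (-t)) := by
    fun_prop
  rw [mq, integrable_withDensity_iff hm (by simp)]
  have h := integrableOn_rpow_mul_exp_neg_mul_rpow (p := 1) (s := n + 2 * q - 1) (b := 1 + c)
    (by have : (0 : ℝ) ≤ n := n.cast_nonneg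
        linarith) one_pos (by linarith)
  refine (integrableOn_congr_fun (fun t ht => ?_) measurableSet_Ioi).1 h
  have ht : 0 < t := ht
  have e : (n : ℝ) + 2 * q - 1 = n + (2 * q - 1) := by ring
  simp only [ENNReal.toReal_ofReal (show 0 ≤ t ^ (2 * q - 1) * Real.exp (-t) by positivity)]
  rw [e, Real.rpow_add ht, Real.rpow_natCast, Real.rpow_one,
    show -(1 + c) * t = -(c * t) + -t by ring, Real.exp_add]
  ring

lemma integral_pow_mul_exp {q : ℝ} (hq : 0 < q) {c : ℝ} (hc : -1 < c) (n : ℕ) :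
    ∫ t, t ^ n * Real.exp (-(c * t)) ∂(mq q) =
      Real.Gamma (n + 2 * q) * (1 + c) ^ (-(n + 2 * q)) := by
  have hm : Measurable fun t : ℝ => ENNReal.ofReal (t ^ (2 * q - 1) * Real.exp (-t)) := by
    fun_prop
  rw [mq, integral_withDensity_eq_integral_toReal_smul₀ hm.aemeasurable (by simp)]
  have h := Real.integral_rpow_mul_exp_neg_mul_Ioi (a := n + 2 * q) (r := 1 + c) (by positivity)
    (by linarith)
  rw [one_div, Real.inv_rpow (by linarith), ← Real.rpow_neg (by linarith)] at h
  rw [mul_comm (Real.Gamma _), ← h]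
  refine setIntegral_congr_fun measurableSet_Ioi fun t ht => ?_
  have ht : 0 < t := ht
  have e : (n : ℝ) + 2 * q - 1 = n + (2 * q - 1) := by ring
  simp only [ENNReal.toReal_ofReal (show 0 ≤ t ^ (2 * q - 1) * Real.exp (-t) by positivity)]
  rw [e, Real.rpow_add ht, Real.rpow_natCast, smul_eq_mul,
    show -((1 + c) * t) = -(c * t) + -t by ring, Real.exp_add]
  ring

lemma integral_exp_mq {q : ℝ} (hq : 0 < q) {c : ℝ} (hc : -1 < c) :
    ∫ t, Real.exp (-(c * t)) ∂(mq q) = Real.Gamma (2 * q) * (1 + c) ^ (-(2 * q)) := by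
  simpa using integral_pow_mul_exp hq hc 0

lemma memLp_exp {q : ℝ} (hq : 0 < q) {b : ℝ} (hb : -(1 / 2) < b) :
    MemLp (fun t : ℝ => (Real.exp (-(b * t)) : ℂ)) 2 (mq q) := by
  have hc : Continuous fun t : ℝ => (Real.exp (-(b * t)) : ℂ) := by fun_prop
  rw [memLp_two_iff_integrable_sq_norm hc.aestronglyMeasurable]
  refine (integrable_pow_mul_exp hq (c := 2 * b) (by linarith) 0).congr
    (Eventually.of_forall fun t => ?_)
  simp only [Complex.norm_real, Real.norm_eq_abs, Real.abs_exp, pow_zero, one_mul]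
  rw [← Real.exp_nat_mul]
  congr 1
  push_cast
  ring

/-- The class in `L²(m_q)` of the exponential `t ↦ e^(-bt)`, for `b > -1/2`. -/
def expVec {q : ℝ} (hq : 0 < q) {b : ℝ} (hb : -(1 / 2) < b) : L2mq q := (memLp_exp hq hb).toLp

lemma expVec_apply {q : ℝ} (hq : 0 < q) {b : ℝ} (hb : -(1 / 2) < b) :
    expVec hq hb =ᵐ[mq q] fun t => (Real.exp (-(b * t)) : ℂ) :=
  (memLp_exp hq hb).coeFn_toLp

lemma expVec_congr {q : ℝ} (hq : 0 < q) {b c : ℝ} (hb : -(1 / 2) < b) (hc : -(1 / 2) < c)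
    (h : b = c) : expVec hq hb = expVec hq hc := by
  subst h; rfl

lemma inner_expVec {q : ℝ} (hq : 0 < q) {b c : ℝ} (hb : -(1 / 2) < b) (hc : -(1 / 2) < c) :
    inner ℂ (expVec hq hb) (expVec hq hc) =
      ((Real.Gamma (2 * q) * (1 + (b + c)) ^ (-(2 * q)) : ℝ) : ℂ) := by
  rw [L2.inner_def, ← integral_exp_mq hq (by linarith), ← integral_complex_ofReal]
  refine integral_congr_ae ?_
  filter_upwards [expVec_apply hq hb, expVec_apply hq hc] with t h1 h2
  rw [h1, h2, RCLike.inner_apply, Complex.conj_ofReal, ← Complex.ofReal_mul, ← Real.exp_add]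
  congr 2
  ring

lemma norm_sq_expVec {q : ℝ} (hq : 0 < q) {b : ℝ} (hb : -(1 / 2) < b) :
    ‖expVec hq hb‖ ^ 2 = Real.Gamma (2 * q) * (1 + 2 * b) ^ (-(2 * q)) := by
  rw [← inner_self_eq_norm_sq (𝕜 := ℂ), inner_expVec, ← two_mul]
  exact RCLike.ofReal_re _

lemma opM_expVec {q : ℝ} (hq : 0 < q) {b : ℝ} (hb : -(1 / 2) < b) :
    opM q (expVec hq hb) = expVec hq (b := 1 + b) (by linarith) := by
  refine Lp.ext ?_
  filter_upwards [opM_apply q (expVec hq hb), expVec_apply hq hb,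
    expVec_apply hq (b := 1 + b) (by linarith)] with t h1 h2 h3
  rw [h1, h2, h3, ← Complex.ofReal_mul, ← Real.exp_add]
  congr 2
  ring

/-- Integrating the power series of `clifford` term by term; each term is a Gamma integral whose
Gamma factor cancels the one in the coefficient. -/
lemma integral_clifford_mul_exp {q : ℝ} (hq : 0 < q) {b : ℝ} (hb : -(1 / 2) < b) {t : ℝ}
    (ht : 0 < t) :
    ∫ s, clifford (2 * q) (s * t) * Real.exp (-(b * s)) ∂(mq q) =
      (1 + b) ^ (-(2 * q)) * Real.exp (-(1 / (1 + b) * t)) := by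
  set F : ℕ → ℝ → ℝ := fun n s =>
    (-1) ^ n / (n.factorial * Real.Gamma (n + 2 * q)) * t ^ n * (s ^ n * Real.exp (-(b * s)))
  have hb1 : 0 < 1 + b := by linarith
  have hG : ∀ n : ℕ, 0 < Real.Gamma (n + 2 * q) := fun n => Real.Gamma_pos_of_pos (by positivity)
  have hFi : ∀ n, Integrable (F n) (mq q) := fun n =>
    (integrable_pow_mul_exp hq (by linarith) n).const_mul _
  have hval : ∀ n : ℕ, Real.Gamma (n + 2 * q) * (1 + b) ^ (-(n + 2 * q)) =
      Real.Gamma (n + 2 * q) * ((1 + b) ^ (-(2 * q)) * (1 / (1 + b)) ^ n) := by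
    intro n
    rw [neg_add, Real.rpow_add hb1, Real.rpow_neg hb1.le, Real.rpow_natCast, one_div, inv_pow,
      mul_comm (((1 + b) ^ n)⁻¹)]
  have hF : ∀ n, ∫ s, F n s ∂(mq q) =
      (1 + b) ^ (-(2 * q)) * ((-(1 / (1 + b) * t)) ^ n / n.factorial) := by
    intro n
    simp only [F]
    rw [integral_const_mul, integral_pow_mul_exp hq (by linarith), hval,
      show -(1 / (1 + b) * t) = (-1) * (1 / (1 + b)) * t by ring, mul_pow, mul_pow]
    have := (hG n).ne'
    field_simp
  have hFn : ∀ n, ∫ s, ‖F n s‖ ∂(mq q) =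
      (1 + b) ^ (-(2 * q)) * ((1 / (1 + b) * t) ^ n / n.factorial) := by
    intro n
    have e : ∀ᵐ s ∂(mq q), ‖F n s‖ =
        1 / (n.factorial * Real.Gamma (n + 2 * q)) * t ^ n * (s ^ n * Real.exp (-(b * s))) := by
      filter_upwards [ae_mq_pos q] with s hs
      have := hG n
      simp only [F]
      rw [Real.norm_eq_abs, abs_mul, abs_mul, abs_div, abs_pow, abs_neg, abs_one, one_pow,
        abs_of_pos (show 0 < n.factorial * Real.Gamma (n + 2 * q) by positivity),
        abs_of_pos (show 0 < t ^ n by positivity),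
        abs_of_pos (show 0 < s ^ n * Real.exp (-(b * s)) by positivity)]
    rw [integral_congr_ae e, integral_const_mul, integral_pow_mul_exp hq (by linarith), hval,
      mul_pow]
    have := (hG n).ne'
    field_simp
  have hsum := hasSum_integral_of_summable_integral_norm hFi (by
    simp_rw [hFn]
    exact (Real.summable_pow_div_factorial _).mul_left _)
  have h2 : HasSum (fun n => ∫ s, F n s ∂(mq q))
      ((1 + b) ^ (-(2 * q)) * Real.exp (-(1 / (1 + b) * t))) := by
    simp_rw [hF]
    have := NormedSpace.expSeries_div_hasSum_exp (𝔸 := ℝ) (-(1 / (1 + b) * t))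
    rw [← Real.exp_eq_exp_ℝ] at this
    exact this.mul_left _
  rw [← hsum.unique h2]
  refine integral_congr_ae (Eventually.of_forall fun s => ?_)
  simp only [F, clifford]
  rw [← tsum_mul_right]
  refine tsum_congr fun n => ?_
  rw [mul_pow]
  ring

/-- `N_q` maps exponentials to multiples of exponentials, acting on exponents by the Gauss-type map
`b ↦ 1 / (1 + b)`, whose positive fixed point is `γ = (√5 - 1) / 2`. -/
lemma opN_expVec {q : ℝ} (hq : 0 < q) {b : ℝ} (hb : -(1 / 2) < b) (hb' : -(1 / 2) < 1 / (1 + b)) :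
    opN hq (expVec hq hb) = (((1 + b) ^ (-(2 * q)) : ℝ) : ℂ) • expVec hq hb' := by
  refine Lp.ext ?_
  filter_upwards [opN_apply hq (expVec hq hb), Lp.coeFn_smul (((1 + b) ^ (-(2 * q)) : ℝ) : ℂ)
    (expVec hq hb'), expVec_apply hq hb', ae_mq_pos q] with t h1 h2 h3 ht
  rw [h1, h2, Pi.smul_apply, h3, smul_eq_mul, ← Complex.ofReal_mul,
    ← integral_clifford_mul_exp hq hb ht, ← integral_complex_ofReal]
  refine integral_congr_ae ?_
  filter_upwards [expVec_apply hq hb, ae_mq_pos q] with s h4 hs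
  rw [h4, kernel_eq q hs ht, ← Complex.ofReal_mul]

/-! ### Density of the exponentials -/

lemma isFiniteMeasure_mq {q : ℝ} (hq : 0 < q) : IsFiniteMeasure (mq q) := by
  have h := integrable_pow_mq hq 0
  simp only [pow_zero] at h
  exact (integrable_const_iff_isFiniteMeasure (one_ne_zero (α := ℝ))).1 h

lemma neg_half_lt_natCast (n : ℕ) : -(1 / 2 : ℝ) < n := by
  have : (0 : ℝ) ≤ n := n.cast_nonneg
  linarith

/-- The functions `p(e^(-t))`, with `p` a polynomial, are in the span of the exponentials. -/
lemma exists_mem_span_polynomial_exp {q : ℝ} (hq : 0 < q) (p : Polynomial ℝ) :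
    ∃ v ∈ Submodule.span ℂ (range fun n : ℕ => expVec hq (neg_half_lt_natCast n)),
      v =ᵐ[mq q] fun t => ((p.eval (Real.exp (-t)) : ℝ) : ℂ) := by
  induction p using Polynomial.induction_on' with
  | add p₁ p₂ h₁ h₂ =>
    obtain ⟨v₁, m₁, h₁⟩ := h₁
    obtain ⟨v₂, m₂, h₂⟩ := h₂
    refine ⟨v₁ + v₂, add_mem m₁ m₂, ?_⟩
    filter_upwards [Lp.coeFn_add v₁ v₂, h₁, h₂] with t h e₁ e₂
    rw [h, Pi.add_apply, e₁, e₂, Polynomial.eval_add, Complex.ofReal_add]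
  | monomial n a =>
    refine ⟨(a : ℂ) • expVec hq (neg_half_lt_natCast n),
      Submodule.smul_mem _ _ (Submodule.subset_span ⟨n, rfl⟩), ?_⟩
    filter_upwards [Lp.coeFn_smul (a : ℂ) (expVec hq (neg_half_lt_natCast n)),
      expVec_apply hq (neg_half_lt_natCast n)] with t h e
    rw [h, Pi.smul_apply, e, Polynomial.eval_monomial, smul_eq_mul, ← Real.exp_nat_mul,
      Complex.ofReal_mul, mul_neg]

/-- Weierstrass approximation in the variable `e^(-t)`. -/
lemma exists_polynomial_exp_near {f : ℝ → ℝ} (hf : Continuous f) (hfc : HasCompactSupport f)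
    {ε : ℝ} (hε : 0 < ε) :
    ∃ p : Polynomial ℝ, ∀ t, 0 < t → |p.eval (Real.exp (-t)) - f t| < ε := by
  obtain ⟨R, hR⟩ := hfc.isCompact.bddAbove
  have hf0 : ∀ t, R < t → f t = 0 := fun t ht =>
    image_eq_zero_of_notMem_tsupport fun h => absurd (hR h) (not_le.2 ht)
  -- `f` as a function of `u = e^(-t)`, with the singularity of `log` at `0` cut off.
  set G : ℝ → ℝ := fun u => f (-Real.log (max u (Real.exp (-(R + 1))))) with hG
  have hpos : ∀ u, 0 < max u (Real.exp (-(R + 1))) := fun u =>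
    (Real.exp_pos _).trans_le (le_max_right _ _)
  have hGc : Continuous G :=
    hf.comp (Continuous.log (by fun_prop) fun u => (hpos u).ne').neg
  obtain ⟨p, hp⟩ := exists_polynomial_near_of_continuousOn 0 1 G hGc.continuousOn ε hε
  refine ⟨p, fun t ht => ?_⟩
  have h := hp (Real.exp (-t)) ⟨(Real.exp_pos _).le, Real.exp_le_one_iff.2 (by linarith)⟩
  have e : G (Real.exp (-t)) = f t := by
    simp only [hG]
    rcases le_total t (R + 1) with h1 | h1
    · rw [max_eq_left (Real.exp_le_exp.2 (by linarith)), Real.log_exp, neg_neg]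
    · rw [max_eq_right (Real.exp_le_exp.2 (by linarith)), Real.log_exp, neg_neg,
        hf0 _ (by linarith), hf0 _ (by linarith)]
  rwa [e] at h

lemma toLp_mem_closure_of_real {q : ℝ} (hq : 0 < q) {f : ℝ → ℝ} (hf : Continuous f)
    (hfc : HasCompactSupport f) (hfm : MemLp (fun t => (f t : ℂ)) 2 (mq q)) :
    hfm.toLp ∈ (Submodule.span ℂ
      (range fun n : ℕ => expVec hq (neg_half_lt_natCast n))).topologicalClosure := by
  have := isFiniteMeasure_mq hq
  rw [← SetLike.mem_coe, Submodule.topologicalClosure_coe, Metric.mem_closure_iff]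
  intro ε hε
  set A := (measureUnivNNReal (mq q) : ℝ) ^ (2 : ENNReal).toReal⁻¹
  have hA : 0 ≤ A := by positivity
  obtain ⟨p, hp⟩ := exists_polynomial_exp_near hf hfc (ε := ε / (A + 1)) (by positivity)
  obtain ⟨v, hv, hve⟩ := exists_mem_span_polynomial_exp hq p
  refine ⟨v, hv, ?_⟩
  rw [dist_comm, dist_eq_norm]
  have h := Lp.norm_le_of_ae_bound (f := v - hfm.toLp) (C := ε / (A + 1)) (by positivity) (by
    filter_upwards [Lp.coeFn_sub v hfm.toLp, hve, hfm.coeFn_toLp, ae_mq_pos q] with t h1 h2 h3 ht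
    rw [h1, Pi.sub_apply, h2, h3, ← Complex.ofReal_sub, Complex.norm_real]
    exact (hp t ht).le)
  refine h.trans_lt ?_
  rw [mul_div_assoc', div_lt_iff₀ (by positivity)]
  change A * ε < _
  nlinarith

/-- The exponentials `e^(-nt)`, `n = 0, 1, 2, …`, span a dense subspace of `L²(m_q)`. -/
lemma dense_span_expVec {q : ℝ} (hq : 0 < q) :
    Dense (Submodule.span ℂ
      (range fun n : ℕ => expVec hq (neg_half_lt_natCast n)) : Set (L2mq q)) := by
  have := isFiniteMeasure_mq hq
  set W := (Submodule.span ℂ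
    (range fun n : ℕ => expVec hq (neg_half_lt_natCast n))).topologicalClosure
    with hW
  have hWc : IsClosed (W : Set (L2mq q)) := Submodule.isClosed_topologicalClosure _
  rw [Submodule.dense_iff_topologicalClosure_eq_top, eq_top_iff]
  rintro φ -
  rw [← hW, ← SetLike.mem_coe, ← hWc.closure_eq, Metric.mem_closure_iff]
  intro ε hε
  obtain ⟨g, hgc, hg, hgcont, hgm⟩ := (Lp.memLp φ).exists_hasCompactSupport_eLpNorm_sub_le
    (by simp) (ε := ENNReal.ofReal (ε / 2)) (by simpa using hε)
  have hre : MemLp (fun t => ((g t).re : ℂ)) 2 (mq q) := hgm.re.ofReal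
  have him : MemLp (fun t => ((g t).im : ℂ)) 2 (mq q) := hgm.im.ofReal
  have h1 : hre.toLp ∈ W := toLp_mem_closure_of_real hq (Complex.continuous_re.comp hgcont)
    (hgc.comp_left Complex.zero_re) hre
  have h2 : him.toLp ∈ W := toLp_mem_closure_of_real hq (Complex.continuous_im.comp hgcont)
    (hgc.comp_left Complex.zero_im) him
  refine ⟨_, add_mem h1 (W.smul_mem Complex.I h2), ?_⟩
  rw [Lp.dist_def]
  refine lt_of_le_of_lt (ENNReal.toReal_le_of_le_ofReal (by positivity)
    ((eLpNorm_congr_ae ?_).trans_le hg)) (half_lt_self hε)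
  filter_upwards [Lp.coeFn_add (hre.toLp) (Complex.I • him.toLp),
    Lp.coeFn_smul Complex.I him.toLp, hre.coeFn_toLp, him.coeFn_toLp] with t e1 e2 e3 e4
  rw [Pi.sub_apply, Pi.sub_apply, e1, Pi.add_apply, e2, Pi.smul_apply, e3, e4, smul_eq_mul,
    mul_comm, Complex.re_add_im]

/-! ### Self-adjointness, norm and compactness of `N_q` -/

lemma neg_half_lt_one_div_one_add {b : ℝ} (hb : -(1 / 2) < b) : -(1 / 2) < 1 / (1 + b) := by
  have : 0 < 1 / (1 + b) := one_div_pos.2 (by linarith)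
  linarith

lemma inner_opN_expVec {q : ℝ} (hq : 0 < q) {b c : ℝ} (hb : -(1 / 2) < b) (hc : -(1 / 2) < c) :
    inner ℂ (opN hq (expVec hq hb)) (expVec hq hc) =
      ((Real.Gamma (2 * q) * (1 + (1 + b) * (1 + c)) ^ (-(2 * q)) : ℝ) : ℂ) := by
  have hb1 : 0 < 1 + b := by linarith
  have hc1 : 0 < 1 + c := by linarith
  rw [opN_expVec hq hb (neg_half_lt_one_div_one_add hb), inner_smul_left, Complex.conj_ofReal,
    inner_expVec, ← Complex.ofReal_mul, mul_left_comm, ← Real.mul_rpow hb1.le (by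
      have := one_div_pos.2 hb1
      linarith)]
  congr 3
  field_simp
  ring

lemma inner_opM_expVec {q : ℝ} (hq : 0 < q) {b c : ℝ} (hb : -(1 / 2) < b) (hc : -(1 / 2) < c) :
    inner ℂ (opM q (expVec hq hb)) (expVec hq hc) =
      ((Real.Gamma (2 * q) * ((1 + b) + (1 + c)) ^ (-(2 * q)) : ℝ) : ℂ) := by
  rw [opM_expVec, inner_expVec]
  congr 3
  ring

lemma isSymmetric_opN {q : ℝ} (hq : 0 < q) : (opN hq).IsSymmetric := by
  refine isSymmetric_of_dense (dense_span_expVec hq) ?_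
  rintro _ ⟨m, rfl⟩ _ ⟨n, rfl⟩
  rw [← inner_conj_symm _ (opN hq _), inner_opN_expVec, inner_opN_expVec, Complex.conj_ofReal,
    mul_comm (1 + (n : ℝ))]

lemma isSymmetric_opM {q : ℝ} (hq : 0 < q) : (opM q).IsSymmetric := by
  refine isSymmetric_of_dense (dense_span_expVec hq) ?_
  rintro _ ⟨m, rfl⟩ _ ⟨n, rfl⟩
  rw [← inner_conj_symm _ (opM q _), inner_opM_expVec, inner_opM_expVec, Complex.conj_ofReal,
    add_comm (1 + (n : ℝ))]

lemma isSymmetric_opP {q : ℝ} (hq : 0 < q) (ε : ℤˣ) : (opP hq ε).IsSymmetric := by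
  have h := (isSymmetric_opM hq).add
    ((isSymmetric_opN hq).smul (c := ((ε : ℤ) : ℂ)) (by simp))
  simpa [opP] using h

lemma sqrt_five_sub_one_half_pos : 0 < (√5 - 1) / 2 := by
  have : (1 : ℝ) < √5 := by
    rw [Real.lt_sqrt (by norm_num)]; norm_num
  linarith

lemma sqrt_five_sub_one_half_sq_add_self : ((√5 - 1) / 2) ^ 2 + (√5 - 1) / 2 = 1 := by
  have : √5 ^ 2 = 5 := Real.sq_sqrt (by norm_num)
  nlinarith

/-- After rescaling by `(1 + γb)^(2q)`, every exponential is multiplied by the same factor `γ^(2q)`,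
because `1 + γ / (1 + b) = γ⁻¹ (1 + γb) / (1 + b)`. -/
lemma opN_weighted_expVec {q : ℝ} (hq : 0 < q) {γ : ℝ} (hγ : 0 < γ) (hγ2 : γ ^ 2 + γ = 1)
    {b : ℝ} (hb : 0 ≤ b) (h1 : -(1 / 2) < b) (h2 : -(1 / 2) < 1 / (1 + b)) :
    opN hq ((((1 + γ * b) ^ (2 * q) : ℝ) : ℂ) • expVec hq h1) =
      ((γ ^ (2 * q) : ℝ) : ℂ) •
        ((((1 + γ * (1 / (1 + b))) ^ (2 * q) : ℝ) : ℂ) • expVec hq h2) := by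
  rw [map_smul, opN_expVec hq h1 h2, smul_smul, smul_smul, ← Complex.ofReal_mul,
    ← Complex.ofReal_mul, ← Real.mul_rpow (by positivity) (by positivity),
    Real.rpow_neg (by positivity), ← Real.inv_rpow (by positivity),
    ← Real.mul_rpow (by positivity) (by positivity)]
  congr 3
  field_simp
  linear_combination (-1 : ℝ) * hγ2

lemma exists_norm_opN_pow_le {q : ℝ} (hq : 0 < q) {γ : ℝ} (hγ : 0 < γ) (hγ2 : γ ^ 2 + γ = 1)
    {B : ℝ} (hB : 1 ≤ B) (n : ℕ) :
    ∀ {b : ℝ} (h1 : -(1 / 2) < b), 0 ≤ b → b ≤ B →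
      ‖(opN hq ^ n) ((((1 + γ * b) ^ (2 * q) : ℝ) : ℂ) • expVec hq h1)‖ ≤
        (1 + γ * B) ^ (2 * q) * √(Real.Gamma (2 * q)) * (γ ^ (2 * q)) ^ n := by
  induction n with
  | zero =>
    intro b h1 hb hbB
    have hG : 0 < Real.Gamma (2 * q) := Real.Gamma_pos_of_pos (by positivity)
    have h : ‖expVec hq h1‖ ≤ √(Real.Gamma (2 * q)) := by
      refine Real.le_sqrt_of_sq_le ?_
      rw [norm_sq_expVec]
      exact mul_le_of_le_one_right hG.le
        (Real.rpow_le_one_of_one_le_of_nonpos (by linarith) (by linarith))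
    rw [pow_zero, pow_zero, mul_one, one_apply_eq_self, norm_smul, Complex.norm_real,
      Real.norm_of_nonneg (by positivity)]
    gcongr
  | succ n ih =>
    intro b h1 hb hbB
    rw [pow_succ, mul_apply_eq_comp, opN_weighted_expVec hq hγ hγ2 hb h1
      (neg_half_lt_one_div_one_add h1), map_smul, norm_smul, Complex.norm_real,
      Real.norm_of_nonneg (by positivity), pow_succ' (γ ^ (2 * q)), mul_left_comm]
    refine mul_le_mul_of_nonneg_left (ih _ (by positivity) ?_) (by positivity)
    exact ((div_le_one (by positivity)).2 (by linarith)).trans hB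

/-- The norm of `N_q` is at most `γ^(2q)`. -/
lemma norm_opN_le {q : ℝ} (hq : 0 < q) : ‖opN hq‖ ≤ ((√5 - 1) / 2) ^ (2 * q) := by
  set γ := (√5 - 1) / 2
  have hγ : 0 < γ := sqrt_five_sub_one_half_pos
  refine norm_le_of_norm_pow_le_of_dense (isSymmetric_opN hq) (by positivity)
    (dense_span_expVec hq) ?_
  rintro _ ⟨m, rfl⟩
  have hm : (0 : ℝ) ≤ m := m.cast_nonneg
  have hw : 0 < (1 + γ * m) ^ (2 * q) := by positivity
  -- All later exponents of the orbit lie in `[0, 1]`, so `1 + m` bounds the orbit.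
  refine ⟨((1 + γ * m) ^ (2 * q))⁻¹ *
    ((1 + γ * (1 + m)) ^ (2 * q) * √(Real.Gamma (2 * q))), fun n => ?_⟩
  have h := exists_norm_opN_pow_le hq hγ sqrt_five_sub_one_half_sq_add_self (B := 1 + m)
    (by linarith) n (neg_half_lt_natCast m) hm (by linarith)
  rw [map_smul, norm_smul, Complex.norm_real, Real.norm_of_nonneg hw.le] at h
  rw [mul_assoc, le_inv_mul_iff₀ hw]
  exact h

/-- `N_q` maps bounded weakly null sequences to null sequences, by dominated convergence. -/
lemma tendsto_opN_of_weaklyNull {q : ℝ} (hq : 0 < q) {x : ℕ → L2mq q} (hx1 : ∀ n, ‖x n‖ ≤ 1)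
    (hx : WeaklyNull x) : Tendsto (fun n => opN hq (x n)) atTop (𝓝 0) := by
  obtain ⟨K, hK, hKb⟩ := exists_kernel_bound hq
  obtain ⟨C, hC, hCb⟩ := exists_kernelIntegral_bound hq
  have hcl := continuous_clifford (b := 2 * q) (by positivity)
  -- For fixed `t`, `N_q φ (t)` is the inner product of `φ` with the section of the kernel at `t`.
  have hpt : ∀ t, 0 < t → Tendsto (fun n => kernelIntegral q (x n) t) atTop (𝓝 0) := by
    intro t ht
    have hk : MemLp (fun s => (clifford (2 * q) (s * t) : ℂ)) 2 (mq q) := by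
      have hc : Continuous fun s => ((clifford (2 * q) (s * t) : ℝ) : ℂ) := by fun_prop
      refine (memLp_weight hq).of_le_mul (c := K * (1 + t)) hc.aestronglyMeasurable ?_
      filter_upwards [ae_mq_pos q] with s hs
      have := hKb s t hs ht
      rwa [Complex.norm_real, Complex.norm_real, Real.norm_eq_abs, Real.norm_eq_abs,
        abs_of_pos (show 0 < 1 + s by linarith), ← kernel_eq q hs ht]
    refine (hx hk.toLp).congr fun n => ?_
    rw [L2.inner_def]
    refine integral_congr_ae ?_
    filter_upwards [hk.coeFn_toLp, ae_mq_pos q] with s h1 hs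
    rw [h1, RCLike.inner_apply, Complex.conj_ofReal, kernel_eq q hs ht, mul_comm]
  have hsq : Tendsto (fun n => ∫ t, ‖kernelIntegral q (x n) t‖ ^ 2 ∂(mq q)) atTop (𝓝 0) := by
    rw [← integral_zero ℝ ℝ (μ := mq q)]
    refine tendsto_integral_of_dominated_convergence
      (fun t => (C * ‖((1 + t : ℝ) : ℂ)‖) ^ 2)
      (fun n => (aestronglyMeasurable_kernelIntegral hq (x n)).norm.pow 2) ?_ (fun n => ?_) ?_
    · have h := (memLp_two_iff_integrable_sq_norm (memLp_weight hq).1).1 (memLp_weight hq)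
      simpa only [mul_pow] using h.const_mul (C ^ 2)
    · filter_upwards [ae_mq_pos q] with t ht
      rw [Real.norm_of_nonneg (by positivity)]
      have h := hCb (x n) t ht
      have h2 : C * ‖x n‖ * ‖((1 + t : ℝ) : ℂ)‖ ≤ C * ‖((1 + t : ℝ) : ℂ)‖ := by
        gcongr
        exact mul_le_of_le_one_right hC (hx1 n)
      gcongr
      exact h.trans h2
    · filter_upwards [ae_mq_pos q] with t ht
      simpa using (hpt t ht).norm.pow 2
  have hnorm : ∀ n, ‖opN hq (x n)‖ ^ 2 = ∫ t, ‖kernelIntegral q (x n) t‖ ^ 2 ∂(mq q) := by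
    intro n
    rw [← inner_self_eq_norm_sq (𝕜 := ℂ), L2.inner_def, ← integral_re (L2.integrable_inner _ _)]
    refine integral_congr_ae ?_
    filter_upwards [opN_apply hq (x n)] with t h
    rw [inner_self_eq_norm_sq, h]
    rfl
  rw [tendsto_zero_iff_norm_tendsto_zero]
  simp_rw [← hnorm] at hsq
  simpa [Real.sqrt_sq] using hsq.sqrt

/-! ### The multiplication operator -/

lemma norm_opM_le (q : ℝ) : ‖opM q‖ ≤ 1 :=
  LinearMap.mkContinuous_norm_le _ zero_le_one _

/-- Outside `[0, 1]`, the operator `z - M` is bounded below. -/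
lemma exists_le_norm_sub_opM (q : ℝ) {z : ℂ} (hz : z ∉ (fun x : ℝ => (x : ℂ)) '' Icc 0 1) :
    ∃ d > 0, ∀ φ : L2mq q, d * ‖φ‖ ≤ ‖z • φ - opM q φ‖ := by
  have hcl : IsClosed ((fun x : ℝ => (x : ℂ)) '' Icc 0 1) :=
    (isCompact_Icc.image Complex.continuous_ofReal).isClosed
  obtain ⟨d, hd, hball⟩ := Metric.isOpen_iff.1 hcl.isOpen_compl z hz
  refine ⟨d, hd, fun φ => ?_⟩
  rw [mul_comm, ← le_div_iff₀ hd, div_eq_inv_mul]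
  refine Lp.norm_le_mul_norm_of_ae_le_mul ?_
  filter_upwards [opM_apply q φ, Lp.coeFn_sub (z • φ) (opM q φ), Lp.coeFn_smul z φ, ae_mq_pos q]
    with t h1 h2 h3 ht
  rw [h2, Pi.sub_apply, h3, Pi.smul_apply, h1, smul_eq_mul, ← sub_mul, norm_mul,
    ← div_eq_inv_mul, le_div_iff₀ hd, mul_comm]
  gcongr
  by_contra! hlt
  have hmem := hball (show (Real.exp (-t) : ℂ) ∈ Metric.ball z d by
    rwa [Metric.mem_ball, dist_comm, dist_eq_norm])
  exact hmem ⟨_, ⟨(Real.exp_pos _).le, Real.exp_le_one_iff.2 (by linarith)⟩, rfl⟩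

/-! ### Positivity of `P_q^±` -/

/-- If the matrix of `2T` on a total sequence is a Gram matrix, the quadratic form of `T` is
nonnegative. -/
lemma re_inner_nonneg_of_gram {H : Type*} [NormedAddCommGroup H] [InnerProductSpace ℂ H]
    {T : H →L[ℂ] H} {e u : ℕ → H} (he : Dense (Submodule.span ℂ (range e) : Set H))
    (h : ∀ m n, 2 * inner ℂ (T (e m)) (e n) = inner ℂ (u m) (u n)) (x : H) :
    0 ≤ (inner ℂ (T x) x).re := by
  refine he.induction (P := fun x => 0 ≤ (inner ℂ (T x) x).re) (fun x hx => ?_)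
    (isClosed_le (by fun_prop) (by fun_prop)) x
  obtain ⟨c, rfl⟩ := (Finsupp.mem_span_range_iff_exists_finsupp).1 hx
  have e1 : 2 * inner ℂ (T (c.sum fun i a => a • e i)) (c.sum fun i a => a • e i) =
      inner ℂ (c.sum fun i a => a • u i) (c.sum fun i a => a • u i) := by
    simp only [Finsupp.sum, map_sum, map_smul, sum_inner, inner_sum, inner_smul_left,
      inner_smul_right, Finset.mul_sum, ← h]
    refine Finset.sum_congr rfl fun i _ => Finset.sum_congr rfl fun j _ => ?_
    ring
  have e2 := congrArg Complex.re e1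
  have e3 := inner_self_nonneg (𝕜 := ℂ) (x := c.sum fun i a => a • u i)
  rw [RCLike.re_to_complex, ← e2] at e3
  simpa using e3

lemma inner_expVec_sub_half {q : ℝ} (hq : 0 < q) {a c : ℝ} (ha : 0 < a) (hc : 0 < c) :
    inner ℂ (expVec hq (b := a - 1 / 2) (by linarith)) (expVec hq (b := c - 1 / 2) (by linarith)) =
      ((Real.Gamma (2 * q) * (a + c) ^ (-(2 * q)) : ℝ) : ℂ) := by
  rw [inner_expVec]
  congr 3
  ring

lemma sign_mul_self (ε : ℤˣ) : ((ε : ℤ) : ℂ) * ((ε : ℤ) : ℂ) = 1 := by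
  rw [← Int.cast_mul, ← Units.val_mul, Int.units_mul_self]
  simp

/-- The quadratic form of `P_q^±` at `φ` is `⟨(1 ± h) ψ, ψ⟩ = ‖ψ ± h ψ‖² / 2` in
`L²(t^(2q-1) dt)`, where `ψ = e^(-t) φ` and `h` is the Hankel transform, a symmetric isometry. It
suffices to check this on exponentials, where it is an identity of Gram matrices. -/
lemma re_inner_opP_nonneg {q : ℝ} (hq : 0 < q) (ε : ℤˣ) (φ : L2mq q) :
    0 ≤ (inner ℂ (opP hq ε φ) φ).re := by
  have ha : ∀ n : ℕ, (0 : ℝ) < 1 + n := fun n => by positivity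
  -- The two summands of `u n` are `e^(-at)` and `± a^(-2q) e^(-t/a)`, its Hankel transform up to
  -- sign, with `a = 1 + n`; the factor `e^(t/2)`, the shift of exponents by `1/2`, carries
  -- `L²(t^(2q-1) dt)` isometrically to `L²(m_q)`.
  refine re_inner_nonneg_of_gram (dense_span_expVec hq)
    (u := fun n => expVec hq (b := (1 + n) - 1 / 2) (by linarith [ha n]) +
      ((ε : ℤ) : ℂ) • (((1 + n : ℝ) ^ (-(2 * q)) : ℝ) : ℂ) •
        expVec hq (b := (1 + n : ℝ)⁻¹ - 1 / 2) (by linarith [inv_pos.2 (ha n)])) ?_ φ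
  intro m n
  have hm := ha m
  have hn := ha n
  have r1 : (1 + (m : ℝ)) ^ (-(2 * q)) * ((1 + (n : ℝ)) ^ (-(2 * q)) *
      (Real.Gamma (2 * q) * ((1 + (m : ℝ))⁻¹ + (1 + (n : ℝ))⁻¹) ^ (-(2 * q)))) =
      Real.Gamma (2 * q) * ((1 + m) + (1 + n)) ^ (-(2 * q)) := by
    rw [mul_left_comm _ (Real.Gamma _), mul_left_comm _ (Real.Gamma _),
      ← Real.mul_rpow (by positivity) (by positivity),
      ← Real.mul_rpow (by positivity) (by positivity)]
    congr 2
    field_simp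
    ring
  have r2 : (1 + (n : ℝ)) ^ (-(2 * q)) *
      (Real.Gamma (2 * q) * ((1 + (m : ℝ)) + (1 + (n : ℝ))⁻¹) ^ (-(2 * q))) =
      Real.Gamma (2 * q) * (1 + (1 + m) * (1 + n)) ^ (-(2 * q)) := by
    rw [mul_left_comm _ (Real.Gamma _), ← Real.mul_rpow (by positivity) (by positivity)]
    congr 2
    field_simp
    ring
  have r3 : (1 + (m : ℝ)) ^ (-(2 * q)) *
      (Real.Gamma (2 * q) * ((1 + (m : ℝ))⁻¹ + (1 + (n : ℝ))) ^ (-(2 * q))) =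
      Real.Gamma (2 * q) * (1 + (1 + m) * (1 + n)) ^ (-(2 * q)) := by
    rw [mul_left_comm _ (Real.Gamma _), ← Real.mul_rpow (by positivity) (by positivity)]
    congr 2
    field_simp
  have hε := sign_mul_self ε
  simp only [opP, add_apply, smul_apply, inner_add_left,
    inner_add_right, inner_smul_left, inner_smul_right, inner_opM_expVec, inner_opN_expVec,
    inner_expVec_sub_half hq hm hn, inner_expVec_sub_half hq (inv_pos.2 hm) (inv_pos.2 hn),
    inner_expVec_sub_half hq hm (inv_pos.2 hn), inner_expVec_sub_half hq (inv_pos.2 hm) hn,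
    map_intCast, Complex.conj_ofReal]
  have c1 := congrArg Complex.ofReal r1
  have c2 := congrArg Complex.ofReal r2
  have c3 := congrArg Complex.ofReal r3
  simp only [Complex.ofReal_mul] at c1 c2 c3 ⊢
  linear_combination (-((ε : ℤ) : ℂ) * ((ε : ℤ) : ℂ)) * c1 - ((ε : ℤ) : ℂ) * c2 -
    ((ε : ℤ) : ℂ) * c3 - Complex.ofReal (Real.Gamma (2 * q)) *
      Complex.ofReal (((1 + m) + (1 + n)) ^ (-(2 * q))) * hε

/-! ### The kernel of `P_q^±` -/

lemma coeFn_sum {α ι : Type*} {m : MeasurableSpace α} {μ : Measure α} (s : Finset ι)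
    (f : ι → Lp ℂ 2 μ) : (∑ i ∈ s, f i : Lp ℂ 2 μ) =ᵐ[μ] fun t => ∑ i ∈ s, f i t := by
  classical
  induction s using Finset.induction_on with
  | empty => exact Lp.coeFn_zero ℂ 2 μ
  | insert i s hi ih =>
    rw [Finset.sum_insert hi]
    filter_upwards [Lp.coeFn_add (f i) (∑ j ∈ s, f j), ih] with t h1 h2
    rw [h1, Pi.add_apply, h2, Finset.sum_insert hi]

lemma linearIndependent_expVec {q : ℝ} (hq : 0 < q) {ι : Type*} {b : ι → ℝ}
    (hb : ∀ i, -(1 / 2) < b i) (hinj : Function.Injective b) :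
    LinearIndependent ℂ fun i => expVec hq (hb i) := by
  rw [linearIndependent_iff']
  intro s g hg i hi
  have hae : ∀ᵐ t ∂(mq q), ∑ i ∈ s, g i * (Real.exp (-(b i * t)) : ℂ) = 0 := by
    have h1 : ∀ᵐ t ∂(mq q), ∀ i ∈ s, (g i • expVec hq (hb i) : L2mq q) t =
        g i * (Real.exp (-(b i * t)) : ℂ) := by
      rw [Finset.eventually_all]
      intro i _
      filter_upwards [Lp.coeFn_smul (g i) (expVec hq (hb i)), expVec_apply hq (hb i)] with t e1 e2
      rw [e1, Pi.smul_apply, e2, smul_eq_mul]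
    have h2 := coeFn_sum s (fun i => g i • expVec hq (hb i))
    rw [hg] at h2
    filter_upwards [h1, h2, Lp.coeFn_zero ℂ 2 (mq q)] with t e1 e2 e3
    rw [← Finset.sum_congr rfl e1, ← e2, e3, Pi.zero_apply]
  have hpos : EqOn (fun t : ℝ => ∑ i ∈ s, g i * (Real.exp (-(b i * t)) : ℂ)) 0 (Ioi 0) := by
    have hm : Measurable fun t : ℝ => ENNReal.ofReal (t ^ (2 * q - 1) * Real.exp (-t)) := by
      fun_prop
    rw [mq, ae_withDensity_iff hm] at hae
    refine Measure.eqOn_open_of_ae_eq (μ := volume) ?_ isOpen_Ioi (by fun_prop) continuousOn_const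
    filter_upwards [hae, ae_restrict_mem measurableSet_Ioi] with t h ht
    have ht : 0 < t := ht
    exact h (by simp only [ne_eq, ENNReal.ofReal_eq_zero, not_le]; positivity)
  -- At the points `t = n + 1`, the exponentials are characters of the monoid `ℕ`.
  set χ : ι → (Multiplicative ℕ →* ℂ) := fun i => powersHom ℂ (Real.exp (-(b i)) : ℂ) with hχ
  have hχinj : Function.Injective χ := by
    intro i j hij
    have := (powersHom ℂ).injective hij
    rw [Complex.ofReal_inj] at this
    exact hinj (neg_injective (Real.exp_injective this))
  have hind := (linearIndependent_monoidHom (Multiplicative ℕ) ℂ).comp χ hχinj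
  rw [linearIndependent_iff'] at hind
  have h0 := hind s (fun i => g i * (Real.exp (-(b i)) : ℂ)) (by
    ext n
    have h := hpos (show ((Multiplicative.toAdd n : ℕ) : ℝ) + 1 ∈ Ioi (0 : ℝ) by
      rw [mem_Ioi]; positivity)
    simp only [Pi.zero_apply] at h ⊢
    rw [← h, Finset.sum_apply]
    refine Finset.sum_congr rfl fun i _ => ?_
    simp only [hχ, Function.comp_apply, Pi.smul_apply, smul_eq_mul, powersHom_apply]
    rw [mul_assoc, ← Complex.ofReal_pow, ← Real.exp_nat_mul, ← Complex.ofReal_mul, ← Real.exp_add]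
    congr 3
    ring) i hi
  simpa using h0

/-- Elements of the kernel of `P_q^±`. Multiplied by `e^(-t)`, the two exponentials become `e^(-at)`
and `e^(-t/a)`, which the Hankel transform exchanges up to factors; so their combination below is
an eigenvector of the Hankel transform for the eigenvalue `∓1`. -/
lemma opP_apply_sub_eq_zero {q : ℝ} (hq : 0 < q) (ε : ℤˣ) {a : ℝ} (ha : 0 < a)
    (h1 : -(1 / 2) < a - 1) (h2 : -(1 / 2) < a⁻¹ - 1) :
    opP hq ε (expVec hq h1 - (((ε : ℤ) : ℂ) * ((a ^ (-(2 * q)) : ℝ) : ℂ)) • expVec hq h2) = 0 := by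
  have hi : 0 < a⁻¹ := inv_pos.2 ha
  have g1 : -(1 / 2) < a := by linarith
  have g2 : -(1 / 2) < a⁻¹ := by linarith
  have m1 : opM q (expVec hq h1) = expVec hq g1 := by
    rw [opM_expVec]; exact expVec_congr _ _ _ (by ring)
  have m2 : opM q (expVec hq h2) = expVec hq g2 := by
    rw [opM_expVec]; exact expVec_congr _ _ _ (by ring)
  have n1 : opN hq (expVec hq h1) = ((a ^ (-(2 * q)) : ℝ) : ℂ) • expVec hq g2 := by
    rw [opN_expVec hq h1 (neg_half_lt_one_div_one_add h1),
      expVec_congr hq (neg_half_lt_one_div_one_add h1) g2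
        (by rw [add_sub_cancel, one_div]), add_sub_cancel]
  have n2 : opN hq (expVec hq h2) = ((a⁻¹ ^ (-(2 * q)) : ℝ) : ℂ) • expVec hq g1 := by
    rw [opN_expVec hq h2 (neg_half_lt_one_div_one_add h2),
      expVec_congr hq (neg_half_lt_one_div_one_add h2) g1
        (by rw [add_sub_cancel, one_div, inv_inv]),
      add_sub_cancel]
  have hr : a ^ (-(2 * q)) * a⁻¹ ^ (-(2 * q)) = 1 := by
    rw [← Real.mul_rpow ha.le hi.le, mul_inv_cancel₀ ha.ne', Real.one_rpow]
  have hr' := congrArg Complex.ofReal hr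
  rw [Complex.ofReal_mul, Complex.ofReal_one] at hr'
  have hε := sign_mul_self ε
  have e : ((ε : ℤ) : ℂ) * ((a ^ (-(2 * q)) : ℝ) : ℂ) *
      (((ε : ℤ) : ℂ) * ((a⁻¹ ^ (-(2 * q)) : ℝ) : ℂ)) = 1 := by
    rw [mul_mul_mul_comm, hε, hr', one_mul]
  simp only [opP, add_apply, smul_apply, map_sub, map_smul, m1, m2, n1, n2, smul_add, smul_smul, e,
    one_smul]
  abel

lemma not_finiteDimensional_eigenspace_zero {q : ℝ} (hq : 0 < q) (ε : ℤˣ) :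
    ¬ FiniteDimensional ℂ (Module.End.eigenspace (opP hq ε).toLinearMap 0) := by
  intro hfin
  set a : ℕ → ℝ := fun n => 1 + 1 / ((n : ℝ) + 2) with ha
  have hn : ∀ n : ℕ, 0 < 1 / ((n : ℝ) + 2) ∧ 1 / ((n : ℝ) + 2) ≤ 1 / 2 := fun n =>
    ⟨by positivity, one_div_le_one_div_of_le (by norm_num) (by linarith [n.cast_nonneg (α := ℝ)])⟩
  have ha1 : ∀ n, 1 < a n := fun n => by simp only [ha]; linarith [(hn n).1]
  have ha2 : ∀ n, a n < 2 := fun n => by simp only [ha]; linarith [(hn n).2]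
  have ha0 : ∀ n, 0 < a n := fun n => one_pos.trans (ha1 n)
  have hainj : Function.Injective a := by
    intro m n h
    simpa [ha] using h
  -- For `a ∈ (1, 2)` both exponents `a - 1` and `a⁻¹ - 1` exceed `-1/2`, and they are all distinct.
  set b : ℕ ⊕ ℕ → ℝ := Sum.elim (fun n => a n - 1) (fun n => (a n)⁻¹ - 1) with hbdef
  have hb : ∀ i, -(1 / 2) < b i := by
    rintro (n | n)
    · simp only [hbdef, Sum.elim_inl]; linarith [ha1 n]
    · simp only [hbdef, Sum.elim_inr]
      have := (inv_lt_inv₀ two_pos (ha0 n)).2 (ha2 n)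
      linarith
  have hlt : ∀ m n, (a n)⁻¹ - 1 < a m - 1 := fun m n => by
    have := inv_lt_one_of_one_lt₀ (ha1 n)
    linarith [ha1 m]
  have hbinj : Function.Injective b := by
    rintro (m | m) (n | n) h <;> simp only [hbdef, Sum.elim_inl, Sum.elim_inr] at h
    · rw [hainj (sub_left_injective h)]
    · exact absurd h (hlt m n).ne'
    · exact absurd h (hlt n m).ne
    · rw [hainj (inv_injective (sub_left_injective h))]
  have hli := linearIndependent_expVec hq hb hbinj
  rw [linearIndependent_iff'] at hli
  set φ : ℕ → Module.End.eigenspace (opP hq ε).toLinearMap 0 := fun n =>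
    ⟨expVec hq (hb (.inl n)) -
      (((ε : ℤ) : ℂ) * ((a n ^ (-(2 * q)) : ℝ) : ℂ)) • expVec hq (hb (.inr n)), by
      rw [Module.End.mem_eigenspace_iff, zero_smul]
      exact opP_apply_sub_eq_zero hq ε (ha0 n) _ _⟩ with hφ
  have hφli : LinearIndependent ℂ φ := by
    rw [linearIndependent_iff']
    intro s g hg i hi
    have hg' := congrArg (fun x : Module.End.eigenspace (opP hq ε).toLinearMap 0 => (x : L2mq q)) hg
    simp only [hφ, Submodule.coe_sum, Submodule.coe_smul, Submodule.coe_zero] at hg'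
    refine hli (s.disjSum s) (Sum.elim g fun n =>
      -(g n * (((ε : ℤ) : ℂ) * ((a n ^ (-(2 * q)) : ℝ) : ℂ)))) ?_ (.inl i) (by simpa using hi)
    rw [Finset.sum_disjSum, ← hg', ← Finset.sum_add_distrib]
    refine Finset.sum_congr rfl fun n _ => ?_
    rw [Sum.elim_inl, Sum.elim_inr, neg_smul, smul_sub, smul_smul, ← sub_eq_add_neg]
  exact not_finite_iff_infinite.2 inferInstance hφli.finite

/-! ### The essential spectrum -/

lemma mq_Ioo_ne_zero {q : ℝ} {a b : ℝ} (ha : 0 ≤ a) (hab : a < b) : mq q (Ioo a b) ≠ 0 := by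
  have hm : Measurable fun t : ℝ => ENNReal.ofReal (t ^ (2 * q - 1) * Real.exp (-t)) := by
    fun_prop
  rw [mq, ne_eq, withDensity_apply_eq_zero' hm.aemeasurable]
  have hsub : Ioo a b ⊆
      {t : ℝ | ENNReal.ofReal (t ^ (2 * q - 1) * Real.exp (-t)) ≠ 0} ∩ Ioo a b := by
    intro t ht
    have ht0 : 0 < t := ha.trans_lt ht.1
    refine ⟨?_, ht⟩
    simp only [mem_ofPred_eq, ne_eq, ENNReal.ofReal_eq_zero, not_le]
    positivity
  refine fun h => absurd (measure_mono_null hsub h) ?_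
  have hpos : Ioo a b ⊆ Ioi 0 := fun t ht => ha.trans_lt ht.1
  rw [Measure.restrict_apply measurableSet_Ioo, inter_eq_left.2 hpos, Real.volume_Ioo]
  simpa using hab

/-- Disjoint intervals of positive measure on which `e^(-t)` converges to a given point of
`[0, 1]`. -/
lemma exists_disjoint_Ioo {z : ℝ} (hz : z ∈ Icc (0 : ℝ) 1) :
    ∃ a b : ℕ → ℝ, (∀ n, 0 ≤ a n) ∧ (∀ n, a n < b n) ∧
      Pairwise (fun m n => Disjoint (Ioo (a m) (b m)) (Ioo (a n) (b n))) ∧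
      ∀ n, ∀ t ∈ Ioo (a n) (b n), |z - Real.exp (-t)| ≤ 1 / ((n : ℝ) + 1) := by
  rcases hz.1.eq_or_lt with rfl | hz0
  · refine ⟨fun n => n, fun n => n + 1, fun n => n.cast_nonneg, fun n => lt_add_one _, ?_, ?_⟩
    · refine (pairwise_disjoint_on _).2 fun m n hmn => ?_
      rw [Set.disjoint_left]
      intro t h1 h2
      have : (m : ℝ) + 1 ≤ n := by exact_mod_cast hmn
      linarith [h1.2, h2.1]
    · intro n t ht
      rw [zero_sub, abs_neg, Real.abs_exp, Real.exp_neg, one_div]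
      have h := Real.add_one_le_exp t
      exact inv_anti₀ (by positivity) (by linarith [ht.1])
  · set t₀ := -Real.log z with ht₀
    have ht₀0 : 0 ≤ t₀ := neg_nonneg.2 (Real.log_nonpos hz0.le hz.2)
    have hzt : z = Real.exp (-t₀) := by rw [ht₀, neg_neg, Real.exp_log hz0]
    refine ⟨fun n => t₀ + 1 / ((n : ℝ) + 2), fun n => t₀ + 1 / ((n : ℝ) + 1),
      fun n => by positivity, fun n => ?_, ?_, ?_⟩
    · have : 1 / ((n : ℝ) + 2) < 1 / ((n : ℝ) + 1) :=
        one_div_lt_one_div_of_lt (by positivity) (by linarith)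
      linarith
    · refine (pairwise_disjoint_on _).2 fun m n hmn => ?_
      rw [Set.disjoint_left]
      intro t h1 h2
      have hmn' : (m : ℝ) + 1 ≤ n := by exact_mod_cast hmn
      have : 1 / ((n : ℝ) + 1) ≤ 1 / ((m : ℝ) + 2) :=
        one_div_le_one_div_of_le (by positivity) (by linarith)
      linarith [h1.1, h2.2]
    · intro n t ht
      have h0 : t₀ < t := lt_trans (by have : 0 < 1 / ((n : ℝ) + 2) := by positivity
                                       linarith) ht.1
      have h1 : Real.exp (-t) = Real.exp (-t₀) * Real.exp (-(t - t₀)) := by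
        rw [← Real.exp_add]; congr 1; ring
      have h2 := Real.add_one_le_exp (-(t - t₀))
      have h3 : Real.exp (-(t - t₀)) ≤ 1 := Real.exp_le_one_iff.2 (by linarith)
      rw [h1, ← hzt, ← mul_one_sub, abs_of_nonneg (mul_nonneg hz0.le (by linarith))]
      calc z * (1 - Real.exp (-(t - t₀))) ≤ 1 * (1 - Real.exp (-(t - t₀))) :=
            mul_le_mul_of_nonneg_right hz.2 (by linarith)
        _ ≤ _ := by linarith [ht.2]

/-- A singular sequence for the multiplication operator at each point of `[0, 1]`. -/
lemma exists_orthonormal_tendsto_opM {q : ℝ} (hq : 0 < q) {z : ℝ} (hz : z ∈ Icc (0 : ℝ) 1) :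
    ∃ x : ℕ → L2mq q, Orthonormal ℂ x ∧
      Tendsto (fun n => (z : ℂ) • x n - opM q (x n)) atTop (𝓝 0) := by
  have := isFiniteMeasure_mq hq
  obtain ⟨a, b, ha, hab, hd, hclose⟩ := exists_disjoint_Ioo hz
  set y : ℕ → L2mq q := fun n =>
    indicatorConstLp 2 (measurableSet_Ioo (a := a n) (b := b n)) (measure_ne_top _ _) (1 : ℂ)
    with hy
  have hy0 : ∀ n, ‖y n‖ ≠ 0 := by
    intro n
    have hpos : 0 < (mq q).real (Ioo (a n) (b n)) :=
      ENNReal.toReal_pos (mq_Ioo_ne_zero (ha n) (hab n)) (measure_ne_top _ _)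
    rw [hy, norm_indicatorConstLp (by simp) (by simp), norm_one, one_mul]
    exact (Real.rpow_pos_of_pos hpos _).ne'
  have hya : ∀ n, y n =ᵐ[mq q] (Ioo (a n) (b n)).indicator fun _ => (1 : ℂ) := fun n =>
    indicatorConstLp_coeFn
  have horth : Pairwise fun m n => inner ℂ (y m) (y n) = 0 := by
    intro m n hmn
    rw [L2.inner_def, ← integral_zero ℝ ℂ (μ := mq q)]
    refine integral_congr_ae ?_
    filter_upwards [hya m, hya n] with t h1 h2
    rw [h1, h2]
    by_cases hm : t ∈ Ioo (a m) (b m)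
    · rw [indicator_of_notMem (Set.disjoint_left.1 (hd hmn) hm), inner_zero_right]
    · rw [indicator_of_notMem hm, inner_zero_left]
  have hyz : ∀ n, ‖(z : ℂ) • y n - opM q (y n)‖ ≤ 1 / ((n : ℝ) + 1) * ‖y n‖ := by
    intro n
    refine Lp.norm_le_mul_norm_of_ae_le_mul ?_
    filter_upwards [hya n, opM_apply q (y n), Lp.coeFn_sub ((z : ℂ) • y n) (opM q (y n)),
      Lp.coeFn_smul (z : ℂ) (y n)] with t h1 h2 h3 h4
    rw [h3, Pi.sub_apply, h4, Pi.smul_apply, h2, smul_eq_mul, ← sub_mul, norm_mul, h1,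
      ← Complex.ofReal_sub, Complex.norm_real]
    by_cases ht : t ∈ Ioo (a n) (b n)
    · gcongr
      exact hclose n t ht
    · simp [indicator_of_notMem ht]
  refine ⟨fun n => ((‖y n‖⁻¹ : ℝ) : ℂ) • y n, ⟨fun n => ?_, fun m n hmn => ?_⟩, ?_⟩
  · rw [norm_smul, Complex.norm_real, norm_inv, norm_norm, inv_mul_cancel₀ (hy0 n)]
  · dsimp only
    rw [inner_smul_left, inner_smul_right, horth hmn, mul_zero, mul_zero]
  · refine squeeze_zero_norm (fun n => ?_) tendsto_one_div_add_atTop_nhds_zero_nat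
    rw [map_smul, smul_comm, ← smul_sub, norm_smul, Complex.norm_real, norm_inv, norm_norm,
      inv_mul_le_iff₀ (lt_of_le_of_ne (norm_nonneg _) (hy0 n).symm), mul_comm]
    exact hyz n

lemma norm_sign (ε : ℤˣ) : ‖((ε : ℤ) : ℂ)‖ = 1 := by
  rcases Int.units_eq_one_or ε with rfl | rfl <;> simp

lemma algebraMap_sub_opP_apply {q : ℝ} (hq : 0 < q) (ε : ℤˣ) (z : ℂ) (φ : L2mq q) :
    (algebraMap ℂ (L2mq q →L[ℂ] L2mq q) z - opP hq ε) φ =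
      z • φ - opM q φ - ((ε : ℤ) : ℂ) • opN hq φ := by
  simp [opP, Algebra.algebraMap_eq_smul_one, sub_sub]

lemma not_isFredholm_of_mem_Icc {q : ℝ} (hq : 0 < q) (ε : ℤˣ) {z : ℝ} (hz : z ∈ Icc (0 : ℝ) 1) :
    ¬ (algebraMap ℂ (L2mq q →L[ℂ] L2mq q) (z : ℂ) - opP hq ε).IsFredholm := by
  obtain ⟨x, hx, hxM⟩ := exists_orthonormal_tendsto_opM hq hz
  have hN := tendsto_opN_of_weaklyNull hq (fun n => (hx.1 n).le) (weaklyNull_of_orthonormal hx)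
  refine not_isFredholm_of_weaklyNull hx.1 (weaklyNull_of_orthonormal hx) ?_
  simp_rw [algebraMap_sub_opP_apply]
  simpa using hxM.sub (hN.const_smul ((ε : ℤ) : ℂ))

/-- With `F` of finite rank close to `N_q`, the operator `z - P_q^±` is the finite rank perturbation
of the invertible operator `z - M ∓ (N_q - F)`. -/
lemma isFredholm_of_notMem_Icc {q : ℝ} (hq : 0 < q) (ε : ℤˣ) {z : ℂ}
    (hz : z ∉ (fun x : ℝ => (x : ℂ)) '' Icc 0 1) :
    (algebraMap ℂ (L2mq q →L[ℂ] L2mq q) z - opP hq ε).IsFredholm := by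
  have hz' : (starRingEnd ℂ) z ∉ (fun x : ℝ => (x : ℂ)) '' Icc 0 1 := by
    rintro ⟨x, hx, h⟩
    refine hz ⟨x, hx, ?_⟩
    rw [← Complex.conj_conj z, ← h]
    exact (Complex.conj_ofReal x).symm
  obtain ⟨d₁, hd₁, h₁⟩ := exists_le_norm_sub_opM q hz
  obtain ⟨d₂, hd₂, h₂⟩ := exists_le_norm_sub_opM q hz'
  set d := min d₁ d₂
  have hd : 0 < d := lt_min hd₁ hd₂
  obtain ⟨F, hF, hNF⟩ := exists_finiteRank_norm_sub_le (dense_span_expVec hq)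
    (fun x hx1 hx => tendsto_opN_of_weaklyNull hq hx1 hx) (half_pos hd)
  set R : L2mq q →L[ℂ] L2mq q := ((ε : ℤ) : ℂ) • (opN hq - F) with hR
  have hRn : ‖R‖ ≤ d / 2 := by rwa [hR, norm_smul, norm_sign, one_mul]
  set A : L2mq q →L[ℂ] L2mq q := algebraMap ℂ (L2mq q →L[ℂ] L2mq q) z - opM q - R with hA
  have e : algebraMap ℂ (L2mq q →L[ℂ] L2mq q) z - opP hq ε = A - ((ε : ℤ) : ℂ) • F := by
    rw [hA, hR, opP, smul_sub]; abel
  rw [e]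
  have hMa : (opM q).adjoint = opM q :=
    ContinuousLinearMap.isSelfAdjoint_iff_isSymmetric.2 (isSymmetric_opM hq)
  have key : ∀ (w : ℂ) (S : L2mq q →L[ℂ] L2mq q) (φ : L2mq q), ‖S‖ ≤ d / 2 →
      d * ‖φ‖ ≤ ‖w • φ - opM q φ‖ → d / 2 * ‖φ‖ ≤ ‖w • φ - opM q φ - S φ‖ := by
    intro w S φ hS hw
    have h1 := norm_sub_norm_le (w • φ - opM q φ) (S φ)
    have h2 : ‖S φ‖ ≤ d / 2 * ‖φ‖ := (S.le_opNorm φ).trans (by gcongr)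
    linarith
  refine isFredholm_sub_of_isUnit (isUnit_of_le_norm_apply (half_pos hd) (fun φ => ?_)
    fun φ => ?_) (hF.smul _)
  · have h := key z R φ hRn ((mul_le_mul_of_nonneg_right (min_le_left _ _)
      (norm_nonneg _)).trans (h₁ φ))
    simpa [hA, Algebra.algebraMap_eq_smul_one] using h
  · have h := key _ R.adjoint φ (by rwa [LinearIsometryEquiv.norm_map])
      ((mul_le_mul_of_nonneg_right (min_le_right _ _) (norm_nonneg _)).trans (h₂ φ))
    rw [hA, Algebra.algebraMap_eq_smul_one, map_sub, map_sub, hMa, map_smulₛₗ,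
      ContinuousLinearMap.adjoint_one]
    simpa using h

lemma essentialSpectrum_opP {q : ℝ} (hq : 0 < q) (ε : ℤˣ) :
    essentialSpectrum (opP hq ε) = (fun x : ℝ => (x : ℂ)) '' Icc 0 1 := by
  ext z
  constructor
  · intro h
    by_contra hz
    exact h (isFredholm_of_notMem_Icc hq ε hz)
  · rintro ⟨x, hx, rfl⟩
    exact not_isFredholm_of_mem_Icc hq ε hx

/-! ### Eigenvalues -/

lemma norm_opP_le {q : ℝ} (hq : 0 < q) (ε : ℤˣ) :
    ‖opP hq ε‖ ≤ 1 + ((√5 - 1) / 2) ^ (2 * q) := by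
  refine (norm_add_le _ _).trans (add_le_add (norm_opM_le q) ?_)
  rw [norm_smul, norm_sign, one_mul]
  exact norm_opN_le hq

lemma eigenvalue_mem_Icc {q : ℝ} (hq : 0 < q) (ε : ℤˣ) {z : ℂ}
    (hz : Module.End.HasEigenvalue (opP hq ε).toLinearMap z) :
    ∃ x ∈ Icc (0 : ℝ) (1 + ((√5 - 1) / 2) ^ (2 * q)), z = (x : ℂ) := by
  have hre : z = (z.re : ℂ) :=
    (Complex.conj_eq_iff_re.1 ((isSymmetric_opP hq ε).conj_eigenvalue_eq_self hz)).symm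
  obtain ⟨v, hv⟩ := hz.exists_hasEigenvector
  have hv0 : 0 < ‖v‖ := norm_pos_iff.2 hv.2
  have hPv : opP hq ε v = z • v := hv.apply_eq_smul
  refine ⟨z.re, ⟨?_, ?_⟩, hre⟩
  · have h := re_inner_opP_nonneg hq ε v
    rw [hPv, hre, inner_smul_left, Complex.conj_ofReal, Complex.re_ofReal_mul,
      inner_self_eq_norm_sq_to_K] at h
    norm_cast at h
    exact nonneg_of_mul_nonneg_left h (pow_pos hv0 2)
  · have h := (opP hq ε).le_opNorm v
    rw [hPv, norm_smul] at h
    exact ((Complex.re_le_norm z).trans (le_of_mul_le_mul_right h hv0)).trans (norm_opP_le hq ε)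

lemma mem_spectrum_of_hasEigenvalue {H : Type*} [NormedAddCommGroup H] [NormedSpace ℂ H]
    {T : H →L[ℂ] H} {z : ℂ} (hz : Module.End.HasEigenvalue T.toLinearMap z) : z ∈ spectrum ℂ T := by
  obtain ⟨v, hv⟩ := hz.exists_hasEigenvector
  rintro ⟨u, hu⟩
  have h0 : (u : H →L[ℂ] H) v = 0 := by
    have : T v = z • v := hv.apply_eq_smul
    rw [hu]
    simp [Algebra.algebraMap_eq_smul_one, this]
  have h1 : (↑u⁻¹ * (u : H →L[ℂ] H)) v = 0 := by
    rw [mul_apply_eq_comp, h0, map_zero]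
  rw [u.inv_mul] at h1
  exact hv.2 h1

lemma finiteDimensional_eigenspace_of_isFredholm {H : Type*} [NormedAddCommGroup H]
    [NormedSpace ℂ H] {T : H →L[ℂ] H} {z : ℂ}
    (hz : (algebraMap ℂ (H →L[ℂ] H) z - T).IsFredholm) :
    FiniteDimensional ℂ (Module.End.eigenspace T.toLinearMap z) := by
  have := hz.finite_ker
  refine Submodule.finiteDimensional_of_le
    (S₂ := (algebraMap ℂ (H →L[ℂ] H) z - T).ker) fun v hv => ?_
  have h : T v = z • v := Module.End.mem_eigenspace_iff.1 hv
  simp [Algebra.algebraMap_eq_smul_one, h]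

end FareyTransfer

end

theorem proposition2p4 (q : ℝ) (hq : 0 < q) (ε : ℤˣ) :
    -- `0` is an eigenvalue of infinite multiplicity
    ¬ FiniteDimensional ℂ (Module.End.eigenspace
        (FareyTransfer.opP hq ε).toLinearMap 0) ∧
    -- all eigenvalues are real and lie in `[0, 1 + γ^(2q)]`
    (∀ z : ℂ, Module.End.HasEigenvalue (FareyTransfer.opP hq ε).toLinearMap z →
      ∃ x ∈ Set.Icc (0 : ℝ) (1 + ((√5 - 1) / 2) ^ (2 * q)), z = (x : ℂ)) ∧
    -- eigenvalues outside `[0,1]` are isolated points of the spectrum, of finite multiplicity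
    (∀ z : ℂ, Module.End.HasEigenvalue (FareyTransfer.opP hq ε).toLinearMap z →
      z ∉ (fun x : ℝ => (x : ℂ)) '' Set.Icc 0 1 →
      (∃ r > 0, Metric.ball z r ∩ spectrum ℂ (FareyTransfer.opP hq ε) = {z}) ∧
      FiniteDimensional ℂ (Module.End.eigenspace
        (FareyTransfer.opP hq ε).toLinearMap z)) ∧
    -- the essential spectrum is `[0,1]`
    FareyTransfer.essentialSpectrum (FareyTransfer.opP hq ε) =
      (fun x : ℝ => (x : ℂ)) '' Set.Icc 0 1 := by
  refine ⟨FareyTransfer.not_finiteDimensional_eigenspace_zero hq ε,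
    fun z hz => FareyTransfer.eigenvalue_mem_Icc hq ε hz, fun z hz hz01 => ?_,
    FareyTransfer.essentialSpectrum_opP hq ε⟩
  have hFred := FareyTransfer.isFredholm_of_notMem_Icc hq ε hz01
  refine ⟨?_, FareyTransfer.finiteDimensional_eigenspace_of_isFredholm hFred⟩
  obtain ⟨x, -, rfl⟩ := FareyTransfer.eigenvalue_mem_Icc hq ε hz
  obtain ⟨r, hr, hsub⟩ := FareyTransfer.exists_ball_inter_spectrum_subset
    (FareyTransfer.isSymmetric_opP hq ε) hFred
  refine ⟨r, hr, hsub.antisymm ?_⟩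
  rw [Set.singleton_subset_iff]
  exact ⟨Metric.mem_ball_self hr, FareyTransfer.mem_spectrum_of_hasEigenvalue hz⟩
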